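/- Let $\mathcal H$ be a separable complex Hilbert space with a canonical symmetry $J=J^*$, $J^2=I$, and the indefinite inner product $[x,y]=(Jx,y)$. Put $P_\pm=\tfrac12(I\pm J)$, $\mathcal H^\pm=P_\pm\mathcal H$, and let $\mathbb C^-$, $\mathbb C^+$ be the open left and right half-planes. An operator $T$ in a Hilbert space is dissipative if $\operatorname{Re}(Tx,x)\le 0$ on $\mathcal D(T)$, and m-dissipative if moreover it has no nontrivial dissipative extension; $T$ is (m-)dissipative in $(\mathcal H,[\cdot,\cdot])$ if $JT$ is (m-)dissipative in $\mathcal H$. An operator $T$ generates a quasi-holomorphic semigroup if $T$ is the generator of a $C_0$-semigroup and for every $\varepsilon>0$ there is $C_\varepsilon$ such that every $\lambda$ with $\operatorname{Re}\lambda>\varepsilon$ lies in $\rho(T)$ and $\|(T-\lambda)^{-1}\|\le C_\varepsilon/|\lambda|$. Let $A$ be dissipative in $(\mathcal H,[\cdot,\cdot])$ with dense domain $\mathcal D(A)=\mathcal D^+\oplus\mathcal D^-$, $\mathcal D^\pm=\mathcal D(A)\cap\mathcal H^\pm$, let $A_{11}=P_+AP_+$, $A_{12}=P_+AP_-$, $A_{21}=P_-AP_+$,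 $A_{22}=P_-AP_-$ be its blocks (operators between $\mathcal H^+$ and $\mathcal H^-$ with domains $\mathcal D^\pm$), and assume: 1. $-A_{22}$ is m-dissipative in $\mathcal H^-$; 2. $F(\mu)=(A_{22}-\mu)^{-1}A_{21}$ has a bounded closure for some $\mu\in\mathbb C^-$; 3. $G(\mu)=A_{12}(A_{22}-\mu)^{-1}$ is compact for some $\mu\in\mathbb C^-$. Assume that the closure $\overline A$ is m-dissipative in $(\mathcal H,[\cdot,\cdot])$. Let $\mathcal L^+$ be a maximal nonnegative subspace (that is, $[x,x]\ge 0$ on $\mathcal L^+$, and $\mathcal L^+$ is maximal with this property) which is $\overline A$-invariant, meaning that $\mathcal D(\overline A)\cap\mathcal L^+$ is dense in $\mathcal L^+$ and $\overline Ax\in\mathcal L^+$ for all $x\in\mathcal D(\overline A)\cap\mathcal L^+$, and suppose that the spectrum of $A_+=\overline A|_{\mathcal L^+}$ lies in the closed left half-plane. Assume that one of the following holds: (i) for some $\mu\in\mathbb C^-$ the closure $\overline S(\mu)$ of the transfer function $S(\mu)=A_{11}-A_{12}(A_{22}-\mu)^{-1}A_{21}$, $\mathcal D(S(\mu))=\mathcal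 D^+$, generates a quasi-holomorphic semigroup in $\mathcal H^+$; (ii) $A_{11}$ generates a quasi-holomorphic semigroup in $\mathcal H^+$ and $A_{21}(A_{11}-\alpha_0)^{-1}$ is bounded for some $\alpha_0\in\mathbb C^+$. Then $A_+$ generates a quasi-holomorphic semigroup in $\mathcal L^+$. -/

import Mathlib

namespace KreinSpace

open Filter Topology
open scoped NNReal

noncomputable section

/-! ### Partially defined operators on normed spaces -/

section PartialOperators

variable {E F G : Type*}
  [NormedAddCommGroup E] [NormedSpace ℂ E]
  [NormedAddCommGroup F] [NormedSpace ℂ F]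
  [NormedAddCommGroup G] [NormedSpace ℂ G]

/-- `R` is a bounded everywhere defined two-sided inverse of `T - z`. -/
def IsInverseOfShift (T : E →ₗ.[ℂ] E) (z : ℂ) (R : E →L[ℂ] E) : Prop :=
  (∀ y : E, ∃ h : R y ∈ T.domain, T ⟨R y, h⟩ - z • R y = y) ∧
    ∀ x : T.domain, R (T x - z • (x : E)) = x

/-- The resolvent set `ρ(T)`. -/
def resolventSetOf (T : E →ₗ.[ℂ] E) : Set ℂ :=
  {z | ∃ R : E →L[ℂ] E, IsInverseOfShift T z R}

/-- The spectrum `σ(T)`. -/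
def spectrumOf (T : E →ₗ.[ℂ] E) : Set ℂ :=
  (resolventSetOf T)ᶜ

open Classical in
/-- The resolvent `(T - z)⁻¹` for `z ∈ ρ(T)` (and `0` for `z ∉ ρ(T)`). -/
def resolventOf (T : E →ₗ.[ℂ] E) (z : ℂ) : E →L[ℂ] E :=
  if h : ∃ R : E →L[ℂ] E, IsInverseOfShift T z R then h.choose else 0

/-- The resolvent is the inverse of `T - z` as soon as `z ∈ ρ(T)`. -/
theorem isInverseOfShift_resolventOf {T : E →ₗ.[ℂ] E} {z : ℂ} (hz : z ∈ resolventSetOf T) :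
    IsInverseOfShift T z (resolventOf T z) := by
  have h : ∃ R : E →L[ℂ] E, IsInverseOfShift T z R := hz
  rw [resolventOf, dif_pos h]
  exact h.choose_spec

/-- The product `T₂ T₁` of partially defined operators on its natural domain
`{x ∈ D(T₁) | T₁ x ∈ D(T₂)}`. -/
def pmul (T₂ : F →ₗ.[ℂ] G) (T₁ : E →ₗ.[ℂ] F) : E →ₗ.[ℂ] G :=
  T₂.comp (T₁.domRestrict ((T₂.domain.comap T₁.toFun).map T₁.domain.subtype)) (by
    rintro ⟨x, ⟨⟨y, hy, hyx⟩, hx⟩⟩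
    have h : T₁.domRestrict ((T₂.domain.comap T₁.toFun).map T₁.domain.subtype)
        ⟨x, ⟨⟨y, hy, hyx⟩, hx⟩⟩ = T₁ y := LinearPMap.domRestrict_apply hyx.symm
    rw [h]
    exact hy)

/-- A bounded everywhere defined operator regarded as a partially defined one. -/
def total (R : E →L[ℂ] F) : E →ₗ.[ℂ] F :=
  (R : E →ₗ[ℂ] F).toPMap ⊤

/-- `T` is bounded on its domain. For a densely defined `T` with values in a Banach space this says
that `T` has a bounded closure. -/
def IsBoundedOn (T : E →ₗ.[ℂ] F) : Prop :=
  ∃ C : ℝ, ∀ x : T.domain, ‖T x‖ ≤ C * ‖(x : E)‖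

/-- `T` is everywhere defined and compact. -/
def IsCompactOn (T : E →ₗ.[ℂ] F) : Prop :=
  T.domain = ⊤ ∧ IsCompactOperator (fun x : T.domain => T x)

/-- A subspace `L` is `T`-invariant: `D(T) ∩ L` is dense in `L` and `T x ∈ L` for all
`x ∈ D(T) ∩ L`. -/
def IsInvariantUnder (T : E →ₗ.[ℂ] E) (L : Submodule ℂ E) : Prop :=
  (L : Set E) ⊆ closure ((T.domain ⊓ L : Submodule ℂ E) : Set E) ∧
    ∀ x : T.domain, (x : E) ∈ L → T x ∈ L

/-- The restriction `T|_L`, an operator in `L` with domain `D(T) ∩ L`. -/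
def restrictTo (T : E →ₗ.[ℂ] E) (L : Submodule ℂ E) (h : IsInvariantUnder T L) : L →ₗ.[ℂ] L where
  domain := T.domain.comap L.subtype
  toFun := LinearMap.codRestrict L
    (T.toFun ∘ₗ L.subtype.restrict (p := T.domain.comap L.subtype) (q := T.domain) fun _ hx => hx)
    fun x => h.2 ⟨(x : L), x.2⟩ (x : L).2

/-- A strongly continuous one-parameter semigroup of bounded operators. -/
structure IsC0Semigroup (U : ℝ≥0 → E →L[ℂ] E) : Prop where
  zero : U 0 = 1
  add : ∀ s t : ℝ≥0, U (s + t) = U s * U t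
  tendsto_zero : ∀ x : E, Tendsto (fun t : ℝ≥0 => U t x) (𝓝 0) (𝓝 x)

/-- `T` is the generator of `U`: `x ∈ D(T)` with `T x = y` iff `(U t x - x) / t → y` as `t ↓ 0`. -/
def IsGeneratorOf (T : E →ₗ.[ℂ] E) (U : ℝ≥0 → E →L[ℂ] E) : Prop :=
  ∀ x y : E, (x, y) ∈ T.graph ↔
    Tendsto (fun t : ℝ≥0 => ((t : ℝ)⁻¹ : ℂ) • (U t x - x)) (𝓝[>] 0) (𝓝 y)

/-- `T` generates a quasi-holomorphic semigroup: `T` is the generator of a `C₀`-semigroup, and for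
every `ε > 0` there is `C` with `‖(T - z)⁻¹‖ ≤ C / |z|` whenever `Re z > ε`. -/
def GeneratesQuasiHolomorphic (T : E →ₗ.[ℂ] E) : Prop :=
  (∃ U : ℝ≥0 → E →L[ℂ] E, IsC0Semigroup U ∧ IsGeneratorOf T U) ∧
    ∀ ε : ℝ, 0 < ε → ∃ C : ℝ, ∀ z : ℂ, ε < z.re →
      z ∈ resolventSetOf T ∧ ‖resolventOf T z‖ ≤ C / ‖z‖

end PartialOperators

/-! ### Dissipative operators in a Hilbert space -/

section Dissipative

variable {E : Type*} [NormedAddCommGroup E] [InnerProductSpace ℂ E]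

/-- `Re (T x, x) ≤ 0` on `D(T)`. -/
def IsDissipative (T : E →ₗ.[ℂ] E) : Prop :=
  ∀ x : T.domain, (inner ℂ (T x) (x : E)).re ≤ 0

/-- `T` is dissipative and has no nontrivial dissipative extension (`≤` is extension). -/
def IsMDissipative (T : E →ₗ.[ℂ] E) : Prop :=
  Maximal IsDissipative T

end Dissipative

/-! ### The space with the indefinite inner product `[x, y] = (J x, y)` -/

section Krein

variable {H : Type*} [NormedAddCommGroup H] [InnerProductSpace ℂ H] [CompleteSpace H]

/-- `J` is a canonical symmetry: `J* = J` and `J² = 1`. -/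
def IsCanonicalSymmetry (J : H →L[ℂ] H) : Prop :=
  IsSelfAdjoint J ∧ J * J = 1

/-- `H⁺`, the range of `P₊ = (1 + J) / 2`, that is, the eigenspace `J x = x`. -/
abbrev plusSpace (J : H →L[ℂ] H) : Submodule ℂ H :=
  (J - 1 : H →L[ℂ] H).ker

/-- `H⁻`, the range of `P₋ = (1 - J) / 2`, that is, the eigenspace `J x = -x`. -/
abbrev minusSpace (J : H →L[ℂ] H) : Submodule ℂ H :=
  (J + 1 : H →L[ℂ] H).ker

/-- The operator `J A`. -/
def symmMul (J : H →L[ℂ] H) (A : H →ₗ.[ℂ] H) : H →ₗ.[ℂ] H :=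
  (J : H →ₗ[ℂ] H).compPMap A

/-- `A` is dissipative in the space with the indefinite inner product. -/
def IsJDissipative (J : H →L[ℂ] H) (A : H →ₗ.[ℂ] H) : Prop :=
  IsDissipative (symmMul J A)

/-- `A` is m-dissipative in the space with the indefinite inner product. -/
def IsJMDissipative (J : H →L[ℂ] H) (A : H →ₗ.[ℂ] H) : Prop :=
  IsMDissipative (symmMul J A)

/-- `[x, x] ≥ 0` on `L`. -/
def IsNonnegative (J : H →L[ℂ] H) (L : Submodule ℂ H) : Prop :=
  ∀ x ∈ L, 0 ≤ (inner ℂ (J x) x).re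

/-- `L` is a maximal nonnegative subspace. -/
def IsMaximalNonnegative (J : H →L[ℂ] H) (L : Submodule ℂ H) : Prop :=
  Maximal (IsNonnegative J) L

/-- The block `P_N A P_M`, as an operator from `M` to `N` with domain `D(A) ∩ M`. -/
def block (A : H →ₗ.[ℂ] H) (M N : Submodule ℂ H) [N.HasOrthogonalProjection] : M →ₗ.[ℂ] N where
  domain := A.domain.comap M.subtype
  toFun := (N.orthogonalProjectionOnto : H →ₗ[ℂ] N) ∘ₗ A.toFun ∘ₗ
    M.subtype.restrict (p := A.domain.comap M.subtype) (q := A.domain) fun _ hx => hx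

/-- `A₁₁ = P₊ A P₊`. -/
def A₁₁ (J : H →L[ℂ] H) (A : H →ₗ.[ℂ] H) : plusSpace J →ₗ.[ℂ] plusSpace J :=
  block A (plusSpace J) (plusSpace J)

/-- `A₁₂ = P₊ A P₋`. -/
def A₁₂ (J : H →L[ℂ] H) (A : H →ₗ.[ℂ] H) : minusSpace J →ₗ.[ℂ] plusSpace J :=
  block A (minusSpace J) (plusSpace J)

/-- `A₂₁ = P₋ A P₊`. -/
def A₂₁ (J : H →L[ℂ] H) (A : H →ₗ.[ℂ] H) : plusSpace J →ₗ.[ℂ] minusSpace J :=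
  block A (plusSpace J) (minusSpace J)

/-- `A₂₂ = P₋ A P₋`. -/
def A₂₂ (J : H →L[ℂ] H) (A : H →ₗ.[ℂ] H) : minusSpace J →ₗ.[ℂ] minusSpace J :=
  block A (minusSpace J) (minusSpace J)

/-- `F(μ) = (A₂₂ - μ)⁻¹ A₂₁`. -/
def opF (J : H →L[ℂ] H) (A : H →ₗ.[ℂ] H) (μ : ℂ) : plusSpace J →ₗ.[ℂ] minusSpace J :=
  pmul (total (resolventOf (A₂₂ J A) μ)) (A₂₁ J A)

/-- `G(μ) = A₁₂ (A₂₂ - μ)⁻¹`. -/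
def opG (J : H →L[ℂ] H) (A : H →ₗ.[ℂ] H) (μ : ℂ) : minusSpace J →ₗ.[ℂ] plusSpace J :=
  pmul (A₁₂ J A) (total (resolventOf (A₂₂ J A) μ))

/-- The transfer function `S(μ) = A₁₁ - A₁₂ (A₂₂ - μ)⁻¹ A₂₁`. -/
def opS (J : H →L[ℂ] H) (A : H →ₗ.[ℂ] H) (μ : ℂ) : plusSpace J →ₗ.[ℂ] plusSpace J :=
  A₁₁ J A - pmul (A₁₂ J A) (opF J A μ)

end Krein

end

end KreinSpace

/-!
The subspace `L` is the graph of a contraction over `H⁺`: the projection `P₊` maps `L`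
isomorphically onto `H⁺`, and `P₋ = K P₊` on `L` with `‖K‖ ≤ 1`
(`IsMaximalNonnegative.exists_equiv`). Hence `A₊ = A|_L` may be studied as an operator in `H⁺`,
where it turns out to be a relatively compact perturbation of the transfer function.

Eliminating the second component (`exists_schur`) gives, for `x` in the domain of `A` and
`G = G(μ)`,
`S(μ) P₊ x = P₊ A x - G P₋ (A - μ) x`.
In this form the relation concerns `A` only; it passes to the closure of `A` once it is rewritten
with a closed operator `S` in place of `S(μ)`, see below. For `x ∈ L` with `A x ∈ L` the right-hand
side is `(1 - G K) P₊ A x + μ G K P₊ x`. Two facts about `G` are needed: it is compact, and its norm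
is as small as desired when `μ` is far to the left (`exists_small_compact_comp_resolvent`). The
latter holds because `G(μ) = G(μ₀) (A₂₂ - μ₀) (A₂₂ - μ)⁻¹`, where the adjoints of the bounded
operators `(A₂₂ - μ₀) (A₂₂ - μ)⁻¹` tend to zero strongly and `G(μ₀)` is compact. So `1 - G K` is
invertible, and it is a compact perturbation of the identity. When `S(μ₁)` is known to generate a
quasi-holomorphic semigroup for some other `μ₁`, the difference `S(μ) - S(μ₁)` is bounded, since `F`
is. When instead `A₁₁` is known to generate one and `A₂₁ = B (A₁₁ - α)` with a bounded `B`, then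
`S(μ) = (1 - G B) A₁₁` up to a bounded operator, and `Λ = (1 - G B)⁻¹` is again a compact
perturbation of the identity. Both cases take the form `S P₊ = (1 - C) P₊ A₊ + D P₊` with `S` a
generator of a quasi-holomorphic semigroup, `C` compact, `1 - C` bounded below and `D` bounded
(`generatesQuasiHolomorphic_restrictTo_of_relation`).

The operators `S (S - z)⁻¹` are bounded for `Re z > ε` and tend to zero strongly as `|z| → ∞`, so
`S (S - z)⁻¹ C` tends to zero in norm. This yields `‖(A₊ - z)⁻¹‖ = O(1 / |z|)` for large `z` with
`Re z > ε` (`exists_norm_le_of_relativelyCompact`). The rest of that half-plane with `|z| ≤ r` is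
bounded and stays away from the spectrum of `A₊`, so there the estimate holds by continuity of the
resolvent (`exists_resolvent_bound_of_large`).

Finally, a resolvent which is `O(1 / |z|)` on every half-plane `Re z > ε` is that of the generator
of a `C₀`-semigroup (`generatesQuasiHolomorphic_of_resolvent_bound`). The semigroup is the inverse
Laplace transform
`U t = (2πi)⁻¹ t⁻¹ ∫ exp (t z) (z - T)⁻² dz`
along `Re z = 1 / t`. The integral converges absolutely, and the choice of the line gives a bound on
`‖U t‖` which is uniform for bounded `t`.
-/

namespace KreinSpace

open Filter Topology MeasureTheory
open scoped NNReal

noncomputable section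

/-! ### Resolvents of partially defined operators -/

section Resolvent

variable {E : Type*} [NormedAddCommGroup E] [NormedSpace ℂ E] {T : E →ₗ.[ℂ] E} {z w : ℂ}

theorem IsInverseOfShift.mem_graph {R : E →L[ℂ] E} (h : IsInverseOfShift T z R) (y : E) :
    (R y, y + z • R y) ∈ T.graph := by
  obtain ⟨h1, h2⟩ := h.1 y
  refine (LinearPMap.mem_graph_iff T).2 ⟨⟨R y, h1⟩, rfl, ?_⟩
  exact eq_add_of_sub_eq h2

theorem IsInverseOfShift.apply_of_mem_graph {R : E →L[ℂ] E} (h : IsInverseOfShift T z R)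
    {x y : E} (hxy : (x, y) ∈ T.graph) : R (y - z • x) = x := by
  obtain ⟨u, rfl, rfl⟩ := (LinearPMap.mem_graph_iff T).1 hxy
  exact h.2 u

theorem isInverseOfShift_of_graph {R : E →L[ℂ] E}
    (h1 : ∀ y, (R y, y + z • R y) ∈ T.graph)
    (h2 : ∀ x y, (x, y) ∈ T.graph → R (y - z • x) = x) : IsInverseOfShift T z R := by
  refine ⟨fun y => ?_, fun x => h2 _ _ (T.mem_graph x)⟩
  obtain ⟨u, hu, hu'⟩ := (LinearPMap.mem_graph_iff T).1 (h1 y)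
  simp only at hu hu'
  have hd : R y ∈ T.domain := hu ▸ u.2
  refine ⟨hd, ?_⟩
  have : u = ⟨R y, hd⟩ := Subtype.ext hu
  rw [← this, hu']
  simp

theorem resolventOf_mem_graph (hz : z ∈ resolventSetOf T) (y : E) :
    (resolventOf T z y, y + z • resolventOf T z y) ∈ T.graph :=
  (isInverseOfShift_resolventOf hz).mem_graph y

theorem resolventOf_apply_of_mem_graph (hz : z ∈ resolventSetOf T) {x y : E}
    (hxy : (x, y) ∈ T.graph) : resolventOf T z (y - z • x) = x :=
  (isInverseOfShift_resolventOf hz).apply_of_mem_graph hxy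

/-- The first resolvent identity. -/
theorem resolventOf_sub (hz : z ∈ resolventSetOf T) (hw : w ∈ resolventSetOf T) :
    resolventOf T z - resolventOf T w = (z - w) • (resolventOf T z * resolventOf T w) := by
  ext y
  have h := resolventOf_apply_of_mem_graph hz (resolventOf_mem_graph hw y)
  simp only [map_sub, map_add, map_smul] at h
  simp only [sub_apply, smul_apply, mul_apply_eq_comp]
  calc resolventOf T z y - resolventOf T w y
      = resolventOf T z y - (resolventOf T z y + w • resolventOf T z (resolventOf T w y) -
          z • resolventOf T z (resolventOf T w y)) := by rw [h]
    _ = _ := by module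

/-- An operator with nonempty resolvent set is closed. -/
theorem isClosed_of_mem_resolventSetOf (hz : z ∈ resolventSetOf T) : T.IsClosed := by
  have : (T.graph : Set (E × E)) = {p | resolventOf T z (p.2 - z • p.1) = p.1} := by
    ext ⟨x, y⟩
    refine ⟨fun h => resolventOf_apply_of_mem_graph hz h, fun h => ?_⟩
    simp only [Set.mem_ofPred_eq] at h
    have h' := resolventOf_mem_graph hz (y - z • x)
    rw [h] at h'
    simpa using h'
  rw [LinearPMap.IsClosed, this]
  exact isClosed_eq (by fun_prop) (by fun_prop)

end Resolvent

/-! ### Families satisfying the resolvent identity -/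

section PseudoResolvent

variable {B : Type*} [NormedRing B] [NormedAlgebra ℂ B] {N : ℂ → B} {Ω : Set ℂ}

/-- `N` satisfies the identity of `z ↦ (z - T)⁻¹` on `Ω`. -/
def IsPseudoResolvent (N : ℂ → B) (Ω : Set ℂ) : Prop :=
  ∀ z ∈ Ω, ∀ w ∈ Ω, N z - N w = (w - z) • (N z * N w)

theorem IsPseudoResolvent.commute (h : IsPseudoResolvent N Ω) {z w : ℂ} (hz : z ∈ Ω)
    (hw : w ∈ Ω) : Commute (N z) (N w) := by
  by_cases hzw : z = w
  · rw [hzw]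
  have h1 := h z hz w hw
  have h2 := h w hw z hz
  have h3 : (w - z) • (N z * N w) = (w - z) • (N w * N z) := by
    rw [← h1, ← neg_sub z w, neg_smul, ← h2]
    abel
  exact smul_right_injective B (sub_ne_zero.2 (Ne.symm hzw)) h3

theorem IsPseudoResolvent.continuousAt (h : IsPseudoResolvent N Ω) {z : ℂ}
    (hz : Ω ∈ 𝓝 z) : ContinuousAt N z := by
  have hzΩ : z ∈ Ω := mem_of_mem_nhds hz
  have key : ∀ᶠ w in 𝓝 z, ‖N w - N z‖ ≤ ‖z - w‖ * (2 * ‖N z‖ * ‖N z‖) := by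
    have h1 : Tendsto (fun w => ‖z - w‖ * ‖N z‖) (𝓝 z) (𝓝 0) := by
      have : Continuous fun w : ℂ => ‖z - w‖ * ‖N z‖ := by fun_prop
      simpa using this.tendsto z
    filter_upwards [hz, h1.eventually (gt_mem_nhds (show (0 : ℝ) < 1 / 2 by norm_num))]
      with w hw hsmall
    have h2 : ‖N w - N z‖ ≤ ‖z - w‖ * (‖N w‖ * ‖N z‖) := by
      rw [h w hw z hzΩ, norm_smul]
      gcongr
      exact norm_mul_le _ _
    have h3 : ‖N w‖ ≤ 2 * ‖N z‖ := by
      have h4 : ‖N w‖ ≤ ‖N w - N z‖ + ‖N z‖ := by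
        simpa using norm_add_le (N w - N z) (N z)
      have h5 : ‖z - w‖ * (‖N w‖ * ‖N z‖) ≤ 1 / 2 * ‖N w‖ := by
        calc _ = ‖z - w‖ * ‖N z‖ * ‖N w‖ := by ring
          _ ≤ _ := by gcongr
      linarith
    refine h2.trans ?_
    gcongr
  rw [ContinuousAt, tendsto_iff_norm_sub_tendsto_zero]
  refine squeeze_zero' (Eventually.of_forall fun _ => norm_nonneg _) key ?_
  have : Continuous fun w : ℂ => ‖z - w‖ * (2 * ‖N z‖ * ‖N z‖) := by fun_prop
  simpa using this.tendsto z

theorem IsPseudoResolvent.hasDerivAt (h : IsPseudoResolvent N Ω) {z : ℂ}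
    (hz : Ω ∈ 𝓝 z) : HasDerivAt N (-(N z * N z)) z := by
  rw [hasDerivAt_iff_tendsto_slope]
  have h1 : Tendsto (fun w => -(N w * N z)) (𝓝[≠] z) (𝓝 (-(N z * N z))) :=
    (((h.continuousAt hz).tendsto.mul_const _).neg).mono_left nhdsWithin_le_nhds
  refine h1.congr' ?_
  filter_upwards [self_mem_nhdsWithin, mem_nhdsWithin_of_mem_nhds hz] with w hw hwΩ
  rw [slope_def_module, h w hwΩ z (mem_of_mem_nhds hz), smul_smul]
  have : w - z ≠ 0 := sub_ne_zero.2 hw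
  rw [← neg_sub w z, mul_neg, inv_mul_cancel₀ this]
  simp

end PseudoResolvent

/-! ### An inverse Laplace integral -/

section Scalar

/-- The vertical line `Re s = 1`, parametrized by the imaginary part. -/
def line (y : ℝ) : ℂ := 1 + y * Complex.I

@[simp] theorem line_re (y : ℝ) : (line y).re = 1 := by simp [line]

@[simp] theorem line_im (y : ℝ) : (line y).im = y := by simp [line]

theorem line_ne_zero (y : ℝ) : line y ≠ 0 := fun h => by
  have := congrArg Complex.re h
  simp at this

theorem norm_line_sq (y : ℝ) : ‖line y‖ ^ 2 = 1 + y ^ 2 := by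
  rw [← Complex.normSq_eq_norm_sq, Complex.normSq_apply]
  simp
  ring

theorem one_le_norm_line (y : ℝ) : 1 ≤ ‖line y‖ := by
  have := norm_line_sq y
  nlinarith [norm_nonneg (line y), sq_nonneg y]

theorem continuous_line : Continuous line := by unfold line; fun_prop

theorem hasDerivAt_line (y : ℝ) : HasDerivAt line Complex.I y := by
  have h : HasDerivAt (fun y : ℝ => (y : ℂ)) 1 y := Complex.ofRealCLM.hasDerivAt
  have h' := (h.mul_const Complex.I).const_add 1
  rw [one_mul] at h'
  exact h'

theorem norm_exp_line (y : ℝ) : ‖Complex.exp (line y)‖ = Real.exp 1 := by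
  rw [Complex.norm_exp, line_re]

theorem integrable_inv_norm_line_sq : Integrable fun y : ℝ => (‖line y‖ ^ 2)⁻¹ := by
  simp_rw [norm_line_sq]
  exact integrable_inv_one_add_sq

theorem integrableOn_mul_exp_neg_mul_line (η : ℝ) :
    IntegrableOn (fun t : ℝ => (t : ℂ) * Complex.exp (-line η * t)) (Set.Ioi 0) := by
  have h : IntegrableOn (fun t : ℝ => Real.exp (-t) * t ^ ((2 : ℝ) - 1)) (Set.Ioi 0) :=
    Real.GammaIntegral_convergent (s := 2) (by norm_num)
  refine Integrable.mono' h (by fun_prop) ?_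
  filter_upwards [ae_restrict_mem measurableSet_Ioi] with t ht
  have : (2 : ℝ) - 1 = 1 := by norm_num
  rw [this, Real.rpow_one, norm_mul, Complex.norm_exp, Complex.norm_real,
    Real.norm_of_nonneg (Set.mem_Ioi.1 ht).le, mul_comm]
  simp

theorem integral_mul_exp_neg_mul_line (η : ℝ) :
    ∫ t : ℝ in Set.Ioi 0, (t : ℂ) * Complex.exp (-line η * t) = (line η ^ 2)⁻¹ := by
  have hr := line_ne_zero η
  set r := line η with hrdef
  have hd : ∀ t : ℝ, HasDerivAt (fun t : ℝ => -((t : ℂ) / r + (r ^ 2)⁻¹) * Complex.exp (-r * t))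
      ((t : ℂ) * Complex.exp (-r * t)) t := by
    intro t
    have h0 : HasDerivAt (fun y : ℝ => (y : ℂ)) 1 t := Complex.ofRealCLM.hasDerivAt
    have h1 := ((h0.div_const r).add_const ((r ^ 2)⁻¹)).neg
    have h2 := (h0.const_mul (-r)).cexp
    convert! h1.mul h2 using 1
    simp only [Pi.neg_apply]
    field_simp
    ring
  have hlim : Tendsto (fun t : ℝ => -((t : ℂ) / r + (r ^ 2)⁻¹) * Complex.exp (-r * t))
      atTop (𝓝 0) := by
    have h1 : Tendsto (fun t : ℝ => (t ^ 1 * Real.exp (-t)) * ‖r‖⁻¹ +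
        ‖(r ^ 2)⁻¹‖ * Real.exp (-t)) atTop (𝓝 (0 * ‖r‖⁻¹ + ‖(r ^ 2)⁻¹‖ * 0)) :=
      ((Real.tendsto_pow_mul_exp_neg_atTop_nhds_zero 1).mul_const _).add
        (Real.tendsto_exp_neg_atTop_nhds_zero.const_mul _)
    simp only [zero_mul, mul_zero, add_zero] at h1
    refine squeeze_zero_norm' ?_ h1
    filter_upwards [eventually_ge_atTop 0] with t ht
    have h2 : ‖Complex.exp (-r * t)‖ = Real.exp (-t) := by
      rw [Complex.norm_exp]
      simp [hrdef]
    rw [norm_mul, h2, norm_neg]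
    have h3 : ‖(t : ℂ) / r + (r ^ 2)⁻¹‖ ≤ t * ‖r‖⁻¹ + ‖(r ^ 2)⁻¹‖ := by
      refine (norm_add_le _ _).trans ?_
      rw [norm_div, Complex.norm_real, Real.norm_of_nonneg ht, div_eq_mul_inv]
    calc _ ≤ (t * ‖r‖⁻¹ + ‖(r ^ 2)⁻¹‖) * Real.exp (-t) := by gcongr
      _ = _ := by ring
  have h := integral_Ioi_of_hasDerivAt_of_tendsto' (a := 0) (fun t _ => hd t)
    (integrableOn_mul_exp_neg_mul_line η) hlim
  rw [h]
  simp

open Real in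
open scoped FourierTransform in
/-- The Laplace transform of `t` is `s⁻²`; this is its inversion at `t = 1`. -/
theorem integral_exp_line_mul_inv_sq :
    ∫ y : ℝ, Complex.exp (line y) * (line y ^ 2)⁻¹ = 2 * π := by
  let f : ℝ → ℂ := fun t => (max t 0 : ℝ) * Real.exp (-t)
  have hfc : Continuous f := by fun_prop
  have hfind : f = (Set.Ioi (0 : ℝ)).indicator fun t : ℝ => (t : ℂ) * Real.exp (-t) := by
    ext t
    by_cases ht : 0 < t
    · simp [f, Set.indicator_of_mem (Set.mem_Ioi.2 ht), max_eq_left ht.le]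
    · simp [f, ht, max_eq_right (not_lt.1 ht)]
  have hfi : Integrable f := by
    rw [hfind, integrable_indicator_iff measurableSet_Ioi]
    have h : IntegrableOn (fun t : ℝ => ((Real.exp (-t) * t ^ ((2 : ℝ) - 1) : ℝ) : ℂ))
        (Set.Ioi 0) := (Real.GammaIntegral_convergent (s := 2) (by norm_num)).ofReal
    refine h.congr_fun (fun t ht => ?_) measurableSet_Ioi
    have : (2 : ℝ) - 1 = 1 := by norm_num
    simp only [this, Real.rpow_one]
    simp [mul_comm]
  have hF : ∀ ξ : ℝ, 𝓕 f ξ = (line (2 * π * ξ) ^ 2)⁻¹ := by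
    intro ξ
    have h1 := integral_mul_exp_neg_mul_line (2 * π * ξ)
    rw [Real.fourier_real_eq_integral_exp_smul, hfind]
    have h2 : ∀ v : ℝ, Complex.exp (↑(-2 * π * v * ξ) * Complex.I) •
        (Set.Ioi (0 : ℝ)).indicator (fun t : ℝ => (t : ℂ) * Real.exp (-t)) v =
        (Set.Ioi (0 : ℝ)).indicator (fun t : ℝ => (t : ℂ) *
          Complex.exp (-line (2 * π * ξ) * t)) v := by
      intro v
      by_cases hv : v ∈ Set.Ioi (0 : ℝ)
      · rw [Set.indicator_of_mem hv, Set.indicator_of_mem hv]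
        rw [smul_eq_mul, mul_left_comm, Complex.ofReal_exp,
          ← Complex.exp_add]
        congr 2
        simp [line]
        ring
      · rw [Set.indicator_of_notMem hv, Set.indicator_of_notMem hv, smul_zero]
    simp_rw [h2]
    rw [integral_indicator measurableSet_Ioi, h1]
  have hFi : Integrable (𝓕 f) := by
    have h0 : (𝓕 f) = fun ξ => (line (2 * π * ξ) ^ 2)⁻¹ := funext hF
    rw [h0]
    have h1 : Integrable fun y : ℝ => (line y ^ 2)⁻¹ := by
      refine integrable_inv_norm_line_sq.mono' ?_ (Eventually.of_forall fun y => by simp)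
      exact (Continuous.inv₀ (continuous_line.pow 2)
        fun y => pow_ne_zero _ (line_ne_zero y)).aestronglyMeasurable
    exact h1.comp_mul_left' (by positivity)
  have hinv := congrFun (hfc.fourierInv_fourier_eq hfi hFi) 1
  rw [Real.fourierInv_eq'] at hinv
  simp_rw [hF] at hinv
  have h4 : ∀ v : ℝ, Complex.exp (↑(2 * π * inner ℝ v 1) * Complex.I) •
      (line (2 * π * v) ^ 2)⁻¹ = (fun y : ℝ => Complex.exp (-1) *
        (Complex.exp (line y) * (line y ^ 2)⁻¹)) (2 * π * v) := by
    intro v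
    simp only [smul_eq_mul]
    rw [← mul_assoc, ← Complex.exp_add]
    congr 2
    simp [line]
  simp_rw [h4] at hinv
  rw [Measure.integral_comp_mul_left (fun y : ℝ => Complex.exp (-1) *
        (Complex.exp (line y) * (line y ^ 2)⁻¹)), integral_const_mul] at hinv
  have h5 : f 1 = Complex.exp (-1) := by simp [f]
  rw [h5, abs_of_pos (by positivity)] at hinv
  have hpi : (π : ℂ) ≠ 0 := by exact_mod_cast Real.pi_ne_zero
  have hexp := Complex.exp_ne_zero (-1)
  rw [Complex.real_smul] at hinv
  push_cast at hinv
  field_simp at hinv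
  simp_rw [← div_eq_mul_inv]
  rw [hinv, mul_comm]

end Scalar

/-! ### The semigroup of a family with decay on half-planes -/

section Contour

variable {B : Type*} [NormedRing B] {N : ℂ → B}

/-- The open right half-plane. -/
def rightHalfPlane : Set ℂ := {z | 0 < z.re}

theorem rightHalfPlane_mem_nhds {z : ℂ} (hz : 0 < z.re) : rightHalfPlane ∈ 𝓝 z :=
  (isOpen_lt continuous_const Complex.continuous_re).mem_nhds hz

/-- `N z = O(1 / |z|)` on every half-plane `Re z > ε`, `ε > 0`. -/
def HasHalfPlaneDecay (N : ℂ → B) : Prop :=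
  ∀ ε : ℝ, 0 < ε → ∃ C : ℝ, ∀ z : ℂ, ε < z.re → ‖N z‖ ≤ C / ‖z‖

theorem line_div_re (t y : ℝ) : (line y / (t : ℂ)).re = 1 / t := by
  rw [Complex.div_ofReal_re, line_re]

theorem line_div_re_pos {t : ℝ} (ht : 0 < t) (y : ℝ) : 0 < (line y / (t : ℂ)).re := by
  rw [line_div_re]; positivity

/-- For bounded `t` the rescaled family `s ↦ t⁻¹ N (s / t)` is `O(1 / |s|)` on the line `Re s = 1`,
uniformly in `t`. -/
theorem HasHalfPlaneDecay.exists_bound_line (hb : HasHalfPlaneDecay N) (τ : ℝ) :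
    ∃ C : ℝ, 0 ≤ C ∧ ∀ t : ℝ, 0 < t → t ≤ τ → ∀ y : ℝ,
      ‖N (line y / t)‖ ≤ C * t * ‖line y‖⁻¹ := by
  by_cases hτ : 0 < τ
  swap
  · exact ⟨0, le_rfl, fun t h1 h2 => absurd (h1.trans_le h2) hτ⟩
  obtain ⟨C, hC⟩ := hb (1 / (2 * τ)) (by positivity)
  have key : ∀ t : ℝ, 0 < t → t ≤ τ → ∀ y : ℝ, ‖N (line y / t)‖ ≤ C * t * ‖line y‖⁻¹ := by
    intro t ht htτ y
    refine (hC _ ?_).trans_eq ?_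
    · rw [line_div_re]
      exact one_div_lt_one_div_of_lt ht (by linarith)
    · rw [norm_div, Complex.norm_real, Real.norm_of_nonneg ht.le]
      have := one_le_norm_line y
      field_simp
  refine ⟨C, ?_, key⟩
  have h := (norm_nonneg _).trans (key τ hτ le_rfl 0)
  have h1 : 0 < τ * ‖line 0‖⁻¹ := mul_pos hτ (inv_pos.2 (by linarith [one_le_norm_line 0]))
  rw [mul_assoc] at h
  exact nonneg_of_mul_nonneg_left h h1

theorem norm_line_inv_pow_le {k : ℕ} (hk : 2 ≤ k) (y : ℝ) :
    (‖line y‖⁻¹) ^ k ≤ (‖line y‖ ^ 2)⁻¹ := by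
  rw [← inv_pow]
  exact pow_le_pow_of_le_one (by positivity) (inv_le_one_of_one_le₀ (one_le_norm_line y)) hk

variable [NormedAlgebra ℂ B]

theorem norm_exp_smul_pow_le {C t y : ℝ} (hC : 0 ≤ C) (ht : 0 < t)
    (h : ‖N (line y / t)‖ ≤ C * t * ‖line y‖⁻¹) {k : ℕ} (hk : 2 ≤ k) :
    ‖Complex.exp (line y) • N (line y / t) ^ k‖ ≤
      Real.exp 1 * (C * t) ^ k * (‖line y‖ ^ 2)⁻¹ := by
  rw [norm_smul, norm_exp_line, mul_assoc]
  gcongr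
  calc ‖N (line y / t) ^ k‖ ≤ ‖N (line y / t)‖ ^ k := norm_pow_le' _ (by omega)
    _ ≤ (C * t * ‖line y‖⁻¹) ^ k := by gcongr
    _ = (C * t) ^ k * (‖line y‖⁻¹) ^ k := mul_pow _ _ _
    _ ≤ _ := by gcongr; exact norm_line_inv_pow_le hk y

theorem IsPseudoResolvent.hasDerivAt_comp_line (hid : IsPseudoResolvent N rightHalfPlane) {t : ℝ}
    (ht : 0 < t) (y : ℝ) : HasDerivAt (fun y : ℝ => N (line y / t))
      (-(Complex.I / t) • (N (line y / t) * N (line y / t))) y := by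
  have h1 := hid.hasDerivAt (rightHalfPlane_mem_nhds (line_div_re_pos ht y))
  have h2 := HasDerivAt.scomp y h1 ((hasDerivAt_line y).div_const (t : ℂ))
  simpa [Function.comp_def] using! h2

theorem IsPseudoResolvent.continuous_comp_line (hid : IsPseudoResolvent N rightHalfPlane) {t : ℝ}
    (ht : 0 < t) : Continuous fun y : ℝ => N (line y / t) :=
  continuous_iff_continuousAt.2 fun y => (hid.hasDerivAt_comp_line ht y).continuousAt

theorem continuous_exp_line : Continuous fun y : ℝ => Complex.exp (line y) :=
  Complex.continuous_exp.comp continuous_line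

theorem integrable_exp_smul_pow (hid : IsPseudoResolvent N rightHalfPlane)
    (hb : HasHalfPlaneDecay N) {t : ℝ} (ht : 0 < t) {k : ℕ} (hk : 2 ≤ k) :
    Integrable fun y : ℝ => Complex.exp (line y) • N (line y / t) ^ k := by
  obtain ⟨C, hC, h⟩ := hb.exists_bound_line t
  refine (integrable_inv_norm_line_sq.const_mul (Real.exp 1 * (C * t) ^ k)).mono' ?_
    (Eventually.of_forall fun y => norm_exp_smul_pow_le hC ht (h t ht le_rfl y) hk)
  exact (continuous_exp_line.smul ((hid.continuous_comp_line ht).pow k)).aestronglyMeasurable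

/-- The semigroup `U t = (2πi)⁻¹ t⁻¹ ∫ exp (t z) N(z)² dz`, the integral running over the vertical
line `Re z = 1 / t` and being written in the variable `s = t z`; for `t ≤ 0` it is set to `1`. The
square, which comes from an integration by parts in the Cauchy integral of `exp (t z) N(z)`, makes
the integral absolutely convergent. -/
def contourSemigroup (N : ℂ → B) (t : ℝ) : B :=
  if t ≤ 0 then 1 else
    (2 * Real.pi : ℂ)⁻¹ • ((t : ℂ) ^ 2)⁻¹ • ∫ y : ℝ, Complex.exp (line y) • N (line y / t) ^ 2

theorem contourSemigroup_zero : contourSemigroup N 0 = 1 := if_pos le_rfl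

theorem contourSemigroup_of_pos {t : ℝ} (ht : 0 < t) : contourSemigroup N t =
    (2 * Real.pi : ℂ)⁻¹ • ((t : ℂ) ^ 2)⁻¹ •
      ∫ y : ℝ, Complex.exp (line y) • N (line y / t) ^ 2 :=
  if_neg (not_le.2 ht)

theorem exists_norm_contourSemigroup_le (hb : HasHalfPlaneDecay N) (τ : ℝ) :
    ∃ M : ℝ, ∀ t : ℝ, t ≤ τ → ‖contourSemigroup N t‖ ≤ M := by
  obtain ⟨C, hC, h⟩ := hb.exists_bound_line τ
  refine ⟨max ‖(1 : B)‖ (‖(2 * Real.pi : ℂ)⁻¹‖ *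
    (Real.exp 1 * C ^ 2 * ∫ y : ℝ, (‖line y‖ ^ 2)⁻¹)), fun t htτ => ?_⟩
  by_cases ht : t ≤ 0
  · rw [contourSemigroup, if_pos ht]
    exact le_max_left _ _
  push Not at ht
  refine le_trans ?_ (le_max_right _ _)
  have h0 : ‖((t : ℂ) ^ 2)⁻¹‖ = (t ^ 2)⁻¹ := by
    rw [norm_inv, norm_pow, Complex.norm_real, Real.norm_of_nonneg ht.le]
  rw [contourSemigroup_of_pos ht, norm_smul, norm_smul, h0]
  refine mul_le_mul_of_nonneg_left ?_ (norm_nonneg _)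
  have h1 : ‖∫ y : ℝ, Complex.exp (line y) • N (line y / t) ^ 2‖ ≤
      ∫ y : ℝ, Real.exp 1 * (C * t) ^ 2 * (‖line y‖ ^ 2)⁻¹ :=
    norm_integral_le_of_norm_le (integrable_inv_norm_line_sq.const_mul _)
      (Eventually.of_forall fun y => norm_exp_smul_pow_le hC ht (h t ht htτ y) le_rfl)
  rw [integral_const_mul] at h1
  calc (t ^ 2)⁻¹ * _ ≤ (t ^ 2)⁻¹ * (Real.exp 1 * (C * t) ^ 2 * ∫ y : ℝ, (‖line y‖ ^ 2)⁻¹) := by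
        gcongr
    _ = _ := by field_simp

theorem commute_integral {f : ℝ → B} {b : B} (hf : Integrable f) (h : ∀ y, Commute b (f y)) :
    Commute b (∫ y, f y) := by
  change b * _ = _ * b
  rw [← integral_const_mul_of_integrable hf, ← integral_mul_const_of_integrable hf]
  exact integral_congr_ae (Eventually.of_forall fun y => h y)

theorem commute_contourSemigroup (hid : IsPseudoResolvent N rightHalfPlane)
    (hb : HasHalfPlaneDecay N) {b : B} (h : ∀ z ∈ rightHalfPlane, Commute b (N z)) (t : ℝ) :
    Commute b (contourSemigroup N t) := by
  by_cases ht : t ≤ 0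
  · rw [contourSemigroup, if_pos ht]
    exact Commute.one_right b
  push Not at ht
  rw [contourSemigroup_of_pos ht]
  refine ((commute_integral (integrable_exp_smul_pow hid hb ht le_rfl) fun y => ?_).smul_right
    _).smul_right _
  exact ((h _ (line_div_re_pos ht y)).pow_right 2).smul_right _

variable {l : ℂ}

theorem IsPseudoResolvent.mul_sub_one (hid : IsPseudoResolvent N rightHalfPlane) {z : ℂ}
    (hz : 0 < z.re) (hl : 0 < l.re) :
    N z * (l • N l - 1) = z • (N z * N l) - N l := by
  have h := hid z hz l hl
  calc N z * (l • N l - 1) = l • (N z * N l) - (N z - N l) - N l := by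
        rw [mul_sub, mul_smul_comm, mul_one]
        abel
    _ = z • (N z * N l) - N l := by
        rw [h]
        module

/-- Integration by parts along the line `Re s = 1`. -/
theorem integral_exp_smul_sq (hid : IsPseudoResolvent N rightHalfPlane)
    (hb : HasHalfPlaneDecay N) {t : ℝ} (ht : 0 < t) :
    ∫ y : ℝ, Complex.exp (line y) • N (line y / t) ^ 2 =
      (2 / t : ℂ) • ∫ y : ℝ, Complex.exp (line y) • N (line y / t) ^ 3 := by
  have hi2 := integrable_exp_smul_pow hid hb ht (le_refl 2)
  have hi3 := integrable_exp_smul_pow hid hb ht (show 2 ≤ 3 by norm_num)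
  have hd : ∀ y : ℝ, HasDerivAt (fun y : ℝ => Complex.exp (line y) • N (line y / t) ^ 2)
      (Complex.I • (Complex.exp (line y) • N (line y / t) ^ 2) -
        (2 * Complex.I / t) • (Complex.exp (line y) • N (line y / t) ^ 3)) y := by
    intro y
    have h1 := (hid.hasDerivAt_comp_line ht y).mul (hid.hasDerivAt_comp_line ht y)
    have h2 := (hasDerivAt_line y).cexp.smul h1
    simp only [pow_succ, pow_zero, one_mul]
    convert! h2 using 1
    simp only [smul_mul_assoc, mul_smul_comm, mul_assoc]
    module
  have hi2' : Integrable fun y : ℝ => Complex.I • (Complex.exp (line y) • N (line y / t) ^ 2) :=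
    hi2.smul Complex.I
  have hi3' : Integrable fun y : ℝ => (2 * Complex.I / t : ℂ) •
      (Complex.exp (line y) • N (line y / t) ^ 3) := hi3.smul (2 * Complex.I / t : ℂ)
  have h0 := integral_eq_zero_of_hasDerivAt_of_integrable hd (hi2'.sub hi3') hi2
  rw [integral_sub hi2' hi3', integral_smul, integral_smul, sub_eq_zero, mul_div_right_comm,
    mul_comm, mul_smul] at h0
  exact smul_right_injective B Complex.I_ne_zero h0

/-- On the range of `N l` the semigroup solves `u' = T u`, where `l N(l) - 1` stands for
`T (l - T)⁻¹`. -/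
theorem hasDerivAt_contourSemigroup_mul (hid : IsPseudoResolvent N rightHalfPlane)
    (hb : HasHalfPlaneDecay N) (hl : 0 < l.re) {t : ℝ} (ht : 0 < t) :
    HasDerivAt (fun t => contourSemigroup N t * N l) (contourSemigroup N t * (l • N l - 1)) t := by
  obtain ⟨C, hC, h⟩ := hb.exists_bound_line (2 * t)
  have hmem : Set.Ioo 0 (2 * t) ∈ 𝓝 t := Ioo_mem_nhds ht (by linarith)
  have hint : ∀ r : ℝ, 0 < r → Integrable fun y : ℝ =>
      ((r : ℂ) ^ 2)⁻¹ • Complex.exp (line y) • (N (line y / r) ^ 2 * N l) := by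
    intro r hr
    have := ((integrable_exp_smul_pow hid hb hr le_rfl).mul_const (N l)).smul (((r : ℂ) ^ 2)⁻¹)
    simpa only [smul_mul_assoc] using! this
  have hint' : Integrable fun y : ℝ =>
      (2 / (t : ℂ) ^ 3) • Complex.exp (line y) • (N (line y / t) ^ 3 * (l • N l - 1)) := by
    have := ((integrable_exp_smul_pow hid hb ht (show 2 ≤ 3 by norm_num)).mul_const
      (l • N l - 1)).smul (2 / (t : ℂ) ^ 3)
    simpa only [smul_mul_assoc] using! this
  have key := (hasDerivAt_integral_of_dominated_loc_of_deriv_le (μ := volume)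
    (F := fun (r : ℝ) (y : ℝ) => ((r : ℂ) ^ 2)⁻¹ • Complex.exp (line y) •
      (N (line y / r) ^ 2 * N l))
    (F' := fun (r : ℝ) (y : ℝ) => (2 / (r : ℂ) ^ 3) • Complex.exp (line y) •
      (N (line y / r) ^ 3 * (l • N l - 1)))
    (bound := fun y => (2 * Real.exp 1 * C ^ 3 * ‖l • N l - 1‖) * (‖line y‖ ^ 2)⁻¹)
    hmem ?_ (hint t ht) hint'.aestronglyMeasurable ?_ (integrable_inv_norm_line_sq.const_mul _)
    ?_).2
  · -- the derivative of the integrand is turned into `T U` by integration by parts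
    have e1 : (fun r => contourSemigroup N r * N l) =ᶠ[𝓝 t] fun r => (2 * Real.pi : ℂ)⁻¹ •
        ∫ y : ℝ, ((r : ℂ) ^ 2)⁻¹ • Complex.exp (line y) • (N (line y / r) ^ 2 * N l) := by
      filter_upwards [hmem] with r hr
      rw [contourSemigroup_of_pos hr.1, integral_smul, smul_mul_assoc, smul_mul_assoc,
        ← integral_mul_const_of_integrable (integrable_exp_smul_pow hid hb hr.1 le_rfl)]
      simp only [smul_mul_assoc]
    have e2 : contourSemigroup N t * (l • N l - 1) = (2 * Real.pi : ℂ)⁻¹ •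
        ∫ y : ℝ, (2 / (t : ℂ) ^ 3) • Complex.exp (line y) •
          (N (line y / t) ^ 3 * (l • N l - 1)) := by
      rw [contourSemigroup_of_pos ht, integral_exp_smul_sq hid hb ht, integral_smul,
        smul_mul_assoc, smul_smul, smul_mul_assoc, ← integral_mul_const_of_integrable
          (integrable_exp_smul_pow hid hb ht (show 2 ≤ 3 by norm_num))]
      simp only [smul_mul_assoc]
      congr 2
      have : (t : ℂ) ≠ 0 := by exact_mod_cast ht.ne'
      field_simp
    rw [e2]
    exact (key.const_smul _).congr_of_eventuallyEq e1
  · filter_upwards [hmem] with r hr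
    exact (hint r hr.1).aestronglyMeasurable
  · refine Eventually.of_forall fun y r hr => ?_
    have hr0 : 0 < r := hr.1
    rw [← smul_mul_assoc, norm_smul]
    have h1 := norm_exp_smul_pow_le hC hr0 (h r hr0 hr.2.le y) (show 2 ≤ 3 by norm_num)
    have h2 : ‖(2 / (r : ℂ) ^ 3)‖ = 2 / r ^ 3 := by
      rw [norm_div, norm_pow, Complex.norm_real, Real.norm_of_nonneg hr0.le]
      norm_num
    rw [h2]
    calc 2 / r ^ 3 * ‖Complex.exp (line y) • N (line y / r) ^ 3 * (l • N l - 1)‖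
        ≤ 2 / r ^ 3 * ((Real.exp 1 * (C * r) ^ 3 * (‖line y‖ ^ 2)⁻¹) * ‖l • N l - 1‖) := by
          gcongr
          exact (norm_mul_le _ _).trans (by gcongr)
      _ = _ := by field_simp
  · refine Eventually.of_forall fun y r hr => ?_
    have hr0 : 0 < r := hr.1
    have hrc : (r : ℂ) ≠ 0 := by exact_mod_cast hr0.ne'
    have hz := line_div_re_pos hr0 y
    have h0 : HasDerivAt (fun y : ℝ => (y : ℂ)) 1 r := Complex.ofRealCLM.hasDerivAt
    have h1 : HasDerivAt (fun r : ℝ => line y / (r : ℂ)) (-(line y) / (r : ℂ) ^ 2) r := by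
      convert! (hasDerivAt_const r (line y)).div h0 hrc using 1
      ring
    have h2 : HasDerivAt (fun r : ℝ => N (line y / r))
        ((line y / (r : ℂ) ^ 2) • (N (line y / r) * N (line y / r))) r := by
      have := HasDerivAt.scomp r (hid.hasDerivAt (rightHalfPlane_mem_nhds hz)) h1
      convert! this using 1
      module
    have h3 : HasDerivAt (fun r : ℝ => ((r : ℂ) ^ 2)⁻¹) (-2 / (r : ℂ) ^ 3) r := by
      convert! (h0.pow 2).inv (pow_ne_zero 2 hrc) using 1
      simp only [Pi.pow_apply, Nat.cast_ofNat, Nat.add_one_sub_one, pow_one]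
      field_simp
    have h22 : HasDerivAt (fun r : ℝ => Complex.exp (line y) •
        (N (line y / r) * N (line y / r) * N l)) _ r :=
      ((h2.mul h2).mul_const (N l)).const_smul (Complex.exp (line y))
    have h4 := h3.smul h22
    have e : (fun r : ℝ => ((r : ℂ) ^ 2)⁻¹ • Complex.exp (line y) • (N (line y / r) ^ 2 * N l)) =
        fun r : ℝ => ((r : ℂ) ^ 2)⁻¹ • Complex.exp (line y) •
          (N (line y / r) * N (line y / r) * N l) := by
      simp only [sq]
    rw [e]
    convert! h4 using 1
    have e3 : N (line y / r) ^ 3 * (l • N l - 1) = (line y / r) •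
        (N (line y / r) * N (line y / r) * N (line y / r) * N l) -
          N (line y / r) * N (line y / r) * N l := by
      rw [pow_succ, mul_assoc, hid.mul_sub_one hz hl, sq, mul_sub, mul_smul_comm]
      simp only [mul_assoc]
    rw [e3]
    simp only [smul_mul_assoc, mul_smul_comm, add_mul, mul_assoc]
    match_scalars <;> (field_simp; try ring)

variable [CompleteSpace B]

/-- On the range of `N l` the semigroup tends to the identity linearly in `t`. -/
theorem exists_norm_contourSemigroup_mul_sub_le (hid : IsPseudoResolvent N rightHalfPlane)
    (hb : HasHalfPlaneDecay N) (hl : 0 < l.re) :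
    ∃ K : ℝ, ∀ t : ℝ, 0 ≤ t → t ≤ 1 → ‖contourSemigroup N t * N l - N l‖ ≤ K * t := by
  obtain ⟨C, hC, h⟩ := hb.exists_bound_line 1
  refine ⟨‖(2 * Real.pi : ℂ)⁻¹‖ * (Real.exp 1 * (C + 1) * C * ‖l • N l - 1‖ *
    ∫ y : ℝ, (‖line y‖ ^ 2)⁻¹), fun t ht0 ht1 => ?_⟩
  rcases ht0.eq_or_lt with rfl | ht
  · simp [contourSemigroup_zero]
  have htc : (t : ℂ) ≠ 0 := by exact_mod_cast ht.ne'
  have hpi : (2 * Real.pi : ℂ) ≠ 0 := by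
    have := Real.pi_ne_zero
    exact mul_ne_zero two_ne_zero (by exact_mod_cast this)
  have hi1 : Integrable fun y : ℝ =>
      ((t : ℂ) ^ 2)⁻¹ • Complex.exp (line y) • (N (line y / t) ^ 2 * N l) := by
    have := ((integrable_exp_smul_pow hid hb ht le_rfl).mul_const (N l)).smul (((t : ℂ) ^ 2)⁻¹)
    simpa only [smul_mul_assoc] using! this
  have hi0 : Integrable fun y : ℝ => Complex.exp (line y) * (line y ^ 2)⁻¹ := by
    refine (integrable_inv_norm_line_sq.const_mul (Real.exp 1)).mono' ?_
      (Eventually.of_forall fun y => ?_)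
    · exact (continuous_exp_line.mul (Continuous.inv₀ (continuous_line.pow 2)
        fun y => pow_ne_zero _ (line_ne_zero y))).aestronglyMeasurable
    · rw [norm_mul, norm_exp_line, norm_inv, norm_pow]
  have hi2 := hi0.smul_const (N l)
  have e : contourSemigroup N t * N l - N l = (2 * Real.pi : ℂ)⁻¹ • ∫ y : ℝ,
      (((t : ℂ) ^ 2)⁻¹ • Complex.exp (line y) • (N (line y / t) ^ 2 * N l) -
        (Complex.exp (line y) * (line y ^ 2)⁻¹) • N l) := by
    rw [integral_sub hi1 hi2, integral_smul, integral_smul_const, integral_exp_line_mul_inv_sq,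
      smul_sub, smul_smul _ _ (N l), inv_mul_cancel₀ hpi, one_smul, contourSemigroup_of_pos ht,
      smul_mul_assoc, smul_mul_assoc,
      ← integral_mul_const_of_integrable (integrable_exp_smul_pow hid hb ht le_rfl)]
    simp only [smul_mul_assoc]
  rw [e, norm_smul, mul_assoc]
  gcongr
  have h1 : ∀ y : ℝ, ‖((t : ℂ) ^ 2)⁻¹ • Complex.exp (line y) • (N (line y / t) ^ 2 * N l) -
        (Complex.exp (line y) * (line y ^ 2)⁻¹) • N l‖ ≤
      (Real.exp 1 * (C + 1) * C * ‖l • N l - 1‖ * t) * (‖line y‖ ^ 2)⁻¹ := by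
    intro y
    have hs := line_ne_zero y
    have hz := line_div_re_pos ht y
    -- with `M = t⁻¹ N (s / t)` this is `M² - s⁻² = (M + s⁻¹) (M - s⁻¹)`
    have e1 : ((t : ℂ) ^ 2)⁻¹ • Complex.exp (line y) • (N (line y / t) ^ 2 * N l) -
        (Complex.exp (line y) * (line y ^ 2)⁻¹) • N l =
        (Complex.exp (line y) * (line y)⁻¹) • (((t : ℂ)⁻¹ • N (line y / t) + (line y)⁻¹ • 1) *
          (N (line y / t) * (l • N l - 1))) := by
      rw [hid.mul_sub_one hz hl]
      simp only [add_mul, mul_sub, smul_mul_assoc, mul_smul_comm, one_mul, sq, mul_assoc]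
      match_scalars <;> (field_simp; try ring)
    have hL := one_le_norm_line y
    have hL0 : 0 < ‖line y‖ := by linarith
    have hN := h t ht ht1 y
    rw [e1, norm_smul, norm_mul, norm_exp_line, norm_inv]
    have h2 : ‖((t : ℂ)⁻¹ • N (line y / t) + (line y)⁻¹ • 1) * (N (line y / t) * (l • N l - 1))‖ ≤
        ((C + 1) * ‖line y‖⁻¹) * (C * t * ‖line y‖⁻¹ * ‖l • N l - 1‖) := by
      rw [add_mul, smul_mul_assoc, smul_mul_assoc, one_mul]
      have h3 : ‖N (line y / t) * (l • N l - 1)‖ ≤ C * t * ‖line y‖⁻¹ * ‖l • N l - 1‖ :=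
        (norm_mul_le _ _).trans (by gcongr)
      have h4 : ‖(t : ℂ)⁻¹ • (N (line y / t) * (N (line y / t) * (l • N l - 1)))‖ ≤
          t⁻¹ * (C * t * ‖line y‖⁻¹ * (C * t * ‖line y‖⁻¹ * ‖l • N l - 1‖)) := by
        rw [norm_smul, norm_inv, Complex.norm_real, Real.norm_of_nonneg ht.le]
        gcongr
        exact (norm_mul_le _ _).trans (by gcongr)
      have h5 : ‖(line y)⁻¹ • (N (line y / t) * (l • N l - 1))‖ ≤
          ‖line y‖⁻¹ * (C * t * ‖line y‖⁻¹ * ‖l • N l - 1‖) := by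
        rw [norm_smul, norm_inv]
        gcongr
      refine (norm_add_le _ _).trans ((add_le_add h4 h5).trans_eq ?_)
      field_simp
    calc _ ≤ Real.exp 1 * ‖line y‖⁻¹ *
          (((C + 1) * ‖line y‖⁻¹) * (C * t * ‖line y‖⁻¹ * ‖l • N l - 1‖)) := by gcongr
      _ = (Real.exp 1 * (C + 1) * C * ‖l • N l - 1‖ * t) * (‖line y‖⁻¹) ^ 3 := by ring
      _ ≤ _ := by
        have h0 := mul_nonneg (norm_nonneg (l • N l - 1)) ht.le
        gcongr
        exact norm_line_inv_pow_le (by norm_num) y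
  refine (norm_integral_le_of_norm_le (integrable_inv_norm_line_sq.const_mul _)
    (Eventually.of_forall h1)).trans_eq ?_
  rw [integral_const_mul]
  ring

theorem continuousOn_contourSemigroup_mul (hid : IsPseudoResolvent N rightHalfPlane)
    (hb : HasHalfPlaneDecay N) (hl : 0 < l.re) :
    ContinuousOn (fun t => contourSemigroup N t * N l) (Set.Ici 0) := by
  intro t ht
  rcases (Set.mem_Ici.1 ht).eq_or_lt with rfl | ht
  · obtain ⟨K, hK⟩ := exists_norm_contourSemigroup_mul_sub_le hid hb hl
    rw [ContinuousWithinAt, contourSemigroup_zero, one_mul, tendsto_iff_norm_sub_tendsto_zero]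
    have h1 : Tendsto (fun t : ℝ => K * t) (𝓝[≥] 0) (𝓝 0) := by
      have : Continuous fun t : ℝ => K * t := by fun_prop
      simpa using (this.tendsto 0).mono_left nhdsWithin_le_nhds
    refine squeeze_zero' (Eventually.of_forall fun _ => norm_nonneg _) ?_ h1
    filter_upwards [self_mem_nhdsWithin, mem_nhdsWithin_of_mem_nhds (Iic_mem_nhds zero_lt_one)]
      with t h0 h1
    exact hK t h0 h1
  · exact (hasDerivAt_contourSemigroup_mul hid hb hl ht).continuousAt.continuousWithinAt

theorem contourSemigroup_add_mul (hid : IsPseudoResolvent N rightHalfPlane)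
    (hb : HasHalfPlaneDecay N) (hl : 0 < l.re) {s t : ℝ} (hs : 0 ≤ s) (ht : 0 ≤ t) :
    contourSemigroup N (s + t) * (N l * N l) =
      contourSemigroup N s * contourSemigroup N t * (N l * N l) := by
  rcases hs.eq_or_lt with rfl | hs
  · rw [zero_add, contourSemigroup_zero, one_mul]
  rcases ht.eq_or_lt with rfl | ht
  · rw [add_zero, contourSemigroup_zero, mul_one]
  set U := contourSemigroup N with hU
  set A := l • N l - 1 with hA
  have hUN : ∀ r, Commute (N l) (U r) := fun r =>
    commute_contourSemigroup hid hb (fun z hz => hid.commute hl hz) r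
  have hUU : ∀ r r', Commute (U r) (U r') := fun r r' =>
    commute_contourSemigroup hid hb (fun z hz =>
      (commute_contourSemigroup hid hb (fun w hw => hid.commute hz hw) r).symm) r'
  have hUA : ∀ r, Commute A (U r) := fun r =>
    ((hUN r).smul_left l).sub_left (Commute.one_left _)
  have hNA : Commute A (N l) := ((Commute.refl (N l)).smul_left l).sub_left (Commute.one_left _)
  -- the function `r ↦ U (s + t - r) N(l) U(r) N(l)` is constant
  let φ : ℝ → B := fun r => (U (s + t - r) * N l) * (U r * N l)
  have hd : ∀ r ∈ Set.Ioo 0 (s + t), HasDerivAt φ 0 r := by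
    intro r hr
    have h1 : HasDerivAt (fun r => U (s + t - r) * N l) (-(U (s + t - r) * A)) r := by
      have := HasDerivAt.scomp r (hasDerivAt_contourSemigroup_mul hid hb hl
        (show 0 < s + t - r by linarith [hr.2])) ((hasDerivAt_id r).const_sub (s + t))
      simpa [Function.comp_def] using! this
    have h2 := h1.mul (hasDerivAt_contourSemigroup_mul hid hb hl hr.1)
    convert! h2 using 1
    have e : U (s + t - r) * A * (U r * N l) = U (s + t - r) * N l * (U r * A) := by
      rw [mul_assoc, mul_assoc, ← mul_assoc A, (hUA r).eq, mul_assoc, hNA.eq, ← mul_assoc (N l),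
        (hUN r).eq, mul_assoc]
    change 0 = -(U (s + t - r) * A) * (U r * N l) + U (s + t - r) * N l * (U r * A)
    rw [neg_mul, e, neg_add_cancel]
  have hcont : ContinuousOn φ (Set.Icc 0 (s + t)) := by
    have hc := continuousOn_contourSemigroup_mul hid hb hl
    refine ContinuousOn.mul ?_ (hc.mono Set.Icc_subset_Ici_self)
    exact hc.comp (by fun_prop) fun r hr => by simpa using hr.2
  have hconst : ∀ r ∈ Set.Ioo 0 (s + t), φ r = φ t := fun r hr =>
    isOpen_Ioo.is_const_of_deriv_eq_zero isPreconnected_Ioo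
      (fun x hx => (hd x hx).differentiableAt.differentiableWithinAt)
      (fun x hx => (hd x hx).deriv) hr ⟨ht, by linarith⟩
  have h0 : Tendsto φ (𝓝[>] 0) (𝓝 (φ 0)) := by
    have h01 : (0 : ℝ) ∈ Set.Icc 0 (s + t) := ⟨le_rfl, by linarith⟩
    refine (hcont 0 h01).tendsto.mono_left ?_
    rw [← nhdsWithin_Ioo_eq_nhdsGT (show (0 : ℝ) < s + t by linarith)]
    exact nhdsWithin_mono _ Set.Ioo_subset_Icc_self
  have h1 : φ 0 = φ t := by
    refine tendsto_nhds_unique h0 (tendsto_const_nhds.congr' ?_)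
    rw [← nhdsWithin_Ioo_eq_nhdsGT (show (0 : ℝ) < s + t by linarith)]
    filter_upwards [self_mem_nhdsWithin] with r hr
    exact (hconst r hr).symm
  simp only [φ, sub_zero, add_sub_cancel_right] at h1
  rw [hU, contourSemigroup_zero, one_mul, ← hU] at h1
  rw [← mul_assoc, h1, mul_assoc, ← mul_assoc (N l), (hUN t).eq]
  simp only [mul_assoc]

end Contour

/-! ### Generation of quasi-holomorphic semigroups -/

section Generation

variable {E F : Type*} [NormedAddCommGroup E] [NormedSpace ℂ E]
  [NormedAddCommGroup F] [NormedSpace ℂ F]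

theorem tendsto_apply_zero_of_dense {ι : Type*} {l : Filter ι} {S : ι → E →L[ℂ] F} {M : ℝ}
    (hM : ∀ᶠ i in l, ‖S i‖ ≤ M) {D : Set E} (hD : Dense D)
    (h : ∀ x ∈ D, Tendsto (fun i => S i x) l (𝓝 0)) (x : E) :
    Tendsto (fun i => S i x) l (𝓝 0) := by
  rw [Metric.tendsto_nhds]
  intro ε hε
  obtain ⟨y, hy, hxy⟩ := hD.exists_dist_lt x (ε := ε / (2 * (|M| + 1))) (by positivity)
  filter_upwards [hM, Metric.tendsto_nhds.1 (h y hy) (ε / 2) (half_pos hε)] with i hi hiy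
  rw [dist_zero_right] at hiy ⊢
  have h1 : ‖S i (x - y)‖ ≤ (|M| + 1) * (ε / (2 * (|M| + 1))) := by
    refine (S i).le_of_opNorm_le_of_le (hi.trans ?_) ?_
    · linarith [le_abs_self M]
    · rw [← dist_eq_norm]; exact hxy.le
  have h2 : (|M| + 1) * (ε / (2 * (|M| + 1))) = ε / 2 := by
    have : |M| + 1 ≠ 0 := by positivity
    field_simp
  calc ‖S i x‖ = ‖S i (x - y) + S i y‖ := by rw [map_sub, sub_add_cancel]
    _ ≤ ‖S i (x - y)‖ + ‖S i y‖ := norm_add_le _ _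
    _ < ε := by linarith

variable {T : E →ₗ.[ℂ] E}

theorem isPseudoResolvent_neg_resolventOf {Ω : Set ℂ} (h : Ω ⊆ resolventSetOf T) :
    IsPseudoResolvent (fun z => -resolventOf T z) Ω := by
  intro z hz w hw
  have := resolventOf_sub (h hz) (h hw)
  rw [neg_mul_neg, neg_sub_neg, ← neg_sub, this, ← neg_smul, neg_sub]

variable [CompleteSpace E]

/-- A densely defined operator whose resolvent is `O(1 / |z|)` on the half-planes `Re z > ε`
generates a `C₀`-semigroup. -/
theorem generatesQuasiHolomorphic_of_resolvent_bound (hd : Dense (T.domain : Set E))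
    (h : ∀ ε : ℝ, 0 < ε → ∃ C : ℝ, ∀ z : ℂ, ε < z.re →
      z ∈ resolventSetOf T ∧ ‖resolventOf T z‖ ≤ C / ‖z‖) : GeneratesQuasiHolomorphic T := by
  refine ⟨?_, h⟩
  let N : ℂ → E →L[ℂ] E := fun z => -resolventOf T z
  have hρ : rightHalfPlane ⊆ resolventSetOf T := fun z hz => by
    obtain ⟨C, hC⟩ := h (z.re / 2) (half_pos hz)
    exact (hC z (half_lt_self hz)).1
  have hid : IsPseudoResolvent N rightHalfPlane := isPseudoResolvent_neg_resolventOf hρ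
  have hb : HasHalfPlaneDecay N := fun ε hε => by
    obtain ⟨C, hC⟩ := h ε hε
    exact ⟨C, fun z hz => by simpa [N] using (hC z hz).2⟩
  have h1 : (0 : ℝ) < (1 : ℂ).re := by simp
  have h1ρ : (1 : ℂ) ∈ resolventSetOf T := hρ h1
  have hgr : ∀ v, (N 1 v, N 1 v - v) ∈ T.graph := fun v => by
    have := T.graph.neg_mem (resolventOf_mem_graph h1ρ v)
    simpa [N, sub_eq_add_neg, add_comm] using this
  have hgr' : ∀ x y, (x, y) ∈ T.graph → N 1 (x - y) = x := fun x y hxy => by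
    have := resolventOf_apply_of_mem_graph h1ρ hxy
    rw [one_smul] at this
    simp only [N, neg_apply]
    rw [← map_neg, neg_sub, this]
  have hdense : DenseRange (N 1) := hd.mono fun x hx => by
    obtain ⟨y, hy⟩ := LinearPMap.mem_domain_iff.1 hx
    exact ⟨_, hgr' x y hy⟩
  have hdense2 : DenseRange (N 1 ∘ N 1) := hdense.comp hdense (N 1).continuous
  set U := contourSemigroup N with hU
  have hcomm : ∀ t x, N 1 (U t x) = U t (N 1 x) := fun t x =>
    DFunLike.congr_fun (commute_contourSemigroup hid hb (fun z hz => hid.commute h1 hz) t).eq x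
  -- strong continuity at zero, first on the range of the resolvent
  have hlim : ∀ x, Tendsto (fun t : ℝ => U t x) (𝓝[≥] 0) (𝓝 x) := by
    intro x
    obtain ⟨M, hM⟩ := exists_norm_contourSemigroup_le hb 1
    have key : Tendsto (fun t : ℝ => (U t - 1) x) (𝓝[≥] 0) (𝓝 0) := by
      refine tendsto_apply_zero_of_dense (M := M + ‖(1 : E →L[ℂ] E)‖) ?_ hdense ?_ x
      · filter_upwards [mem_nhdsWithin_of_mem_nhds (Iic_mem_nhds zero_lt_one)] with t ht
        exact (norm_sub_le _ _).trans (add_le_add_left (hM t ht) _)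
      · rintro _ ⟨v, rfl⟩
        have hc := (continuousOn_contourSemigroup_mul hid hb h1) 0 (Set.mem_Ici.2 le_rfl)
        have := ((ContinuousLinearMap.apply ℂ E v).continuous.tendsto _).comp hc.tendsto
        rw [contourSemigroup_zero, one_mul] at this
        have h2 := this.sub_const (N 1 v)
        simpa [Function.comp_def] using! h2
    have := key.add_const x
    simpa using this
  have hder : ∀ x y, (x, y) ∈ T.graph → ∀ t, 0 < t → HasDerivAt (fun t => U t x) (U t y) t := by
    intro x y hxy t ht
    have h2 := (ContinuousLinearMap.apply ℂ E (x - y)).hasFDerivAt.restrictScalars ℝ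
      |>.comp_hasDerivAt t (hasDerivAt_contourSemigroup_mul hid hb h1 ht)
    have h3 : ((1 : ℂ) • N 1 - 1) (x - y) = y := by
      simp [hgr' x y hxy]
    have h4 : (U t * ((1 : ℂ) • N 1 - 1)) (x - y) = U t y := by
      rw [mul_apply_eq_comp, h3]
    have h5 : ∀ t, (U t * N 1) (x - y) = U t x := fun t => by
      rw [mul_apply_eq_comp, hgr' x y hxy]
    have h6 : HasDerivAt (fun t => (U t * N 1) (x - y))
        ((U t * ((1 : ℂ) • N 1 - 1)) (x - y)) t := h2
    rw [h4] at h6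
    simpa only [h5] using h6
  have hcoe : Tendsto (fun t : ℝ≥0 => (t : ℝ)) (𝓝[>] 0) (𝓝[>] 0) := by
    refine tendsto_nhdsWithin_iff.2 ⟨?_, ?_⟩
    · exact (NNReal.continuous_coe.tendsto 0).mono_left nhdsWithin_le_nhds
    · filter_upwards [self_mem_nhdsWithin] with t ht
      exact NNReal.coe_pos.2 ht
  -- the derivative `U t y` for `t > 0` tends to `y`, which is therefore the derivative at zero
  have hgen : ∀ x y, (x, y) ∈ T.graph →
      Tendsto (fun t : ℝ≥0 => ((t : ℝ)⁻¹ : ℂ) • (U t x - x)) (𝓝[>] 0) (𝓝 y) := by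
    intro x y hxy
    have h2 : HasDerivWithinAt (fun t => U t x) y (Set.Ici 0) 0 := by
      refine hasDerivWithinAt_Ici_of_tendsto_deriv (s := Set.Ioi 0)
        (fun t ht => (hder x y hxy t ht).differentiableAt.differentiableWithinAt) ?_
        self_mem_nhdsWithin ?_
      · rw [ContinuousWithinAt, hU, contourSemigroup_zero]
        exact (hlim x).mono_left (nhdsWithin_mono _ Set.Ioi_subset_Ici_self)
      · refine ((hlim y).mono_left (nhdsWithin_mono _ Set.Ioi_subset_Ici_self)).congr' ?_
        filter_upwards [self_mem_nhdsWithin] with t ht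
        exact (hder x y hxy t ht).deriv.symm
    have h3 := (hasDerivWithinAt_iff_tendsto_slope' (by simp)).1
      (h2.mono Set.Ioi_subset_Ici_self)
    refine (h3.comp hcoe).congr fun t => ?_
    rw [Function.comp_apply, slope_def_module, sub_zero, hU, contourSemigroup_zero,
      ← Complex.ofReal_inv, Complex.coe_smul]
    rfl
  refine ⟨fun t => U t, ⟨?_, ?_, ?_⟩, fun x y => ⟨hgen x y, fun hxy => ?_⟩⟩
  · exact contourSemigroup_zero
  · intro s t
    refine DFunLike.coe_injective (hdense2.equalizer (ContinuousLinearMap.continuous _)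
      (ContinuousLinearMap.continuous _) (funext fun v => ?_))
    have := DFunLike.congr_fun
      (contourSemigroup_add_mul hid hb h1 s.coe_nonneg t.coe_nonneg) v
    simpa using this
  · intro x
    refine (hlim x).comp (tendsto_nhdsWithin_iff.2 ⟨?_, Eventually.of_forall fun t => ?_⟩)
    · exact NNReal.continuous_coe.tendsto 0
    · exact t.coe_nonneg
  -- conversely, applying the resolvent to a convergent difference quotient at `x` shows that `x`
  -- lies in the domain of `T`
  · have h2 := ((N 1).continuous.tendsto y).comp hxy
    have h3 : N 1 y = N 1 x - x := by
      refine tendsto_nhds_unique h2 ((hgen _ _ (hgr x)).congr fun t => ?_)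
      simp only [Function.comp_apply, map_smul, map_sub, hcomm]
    have h4 : N 1 (x - y) = x := by rw [map_sub, h3, sub_sub_cancel]
    have := hgr (x - y)
    rwa [h4, sub_sub_cancel] at this

end Generation

/-! ### Closable operators -/

section Closable

variable {E F : Type*} [NormedAddCommGroup E] [NormedSpace ℂ E]
  [NormedAddCommGroup F] [NormedSpace ℂ F]

theorem isClosable_of_forall_zero {T : E →ₗ.[ℂ] F}
    (h : ∀ y, ((0 : E), y) ∈ T.graph.topologicalClosure → y = 0) : T.IsClosable := by
  refine ⟨T.graph.topologicalClosure.toLinearPMap, ?_⟩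
  rw [Submodule.toLinearPMap_graph_eq]
  rintro ⟨x, y⟩ hx rfl
  exact h y hx

end Closable

/-! ### m-dissipative operators -/

section MDissipative

variable {E : Type*} [NormedAddCommGroup E] [InnerProductSpace ℂ E] {T : E →ₗ.[ℂ] E}

theorem isDissipative_iff_graph :
    IsDissipative T ↔ ∀ u v, (u, v) ∈ T.graph → (inner ℂ v u).re ≤ 0 := by
  refine ⟨fun h u v huv => ?_, fun h x => h _ _ (T.mem_graph x)⟩
  obtain ⟨x, rfl, rfl⟩ := (LinearPMap.mem_graph_iff T).1 huv
  exact h x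

theorem IsDissipative.re_inner_le_of_mem_closure (h : IsDissipative T) {u v : E}
    (huv : (u, v) ∈ T.graph.topologicalClosure) : (inner ℂ v u).re ≤ 0 := by
  have hc : IsClosed {p : E × E | (inner ℂ p.2 p.1).re ≤ 0} :=
    isClosed_le (Complex.continuous_re.comp (continuous_snd.inner continuous_fst))
      continuous_const
  exact closure_minimal (fun p hp => isDissipative_iff_graph.1 h p.1 p.2 hp) hc huv

theorem IsDissipative.isClosable (h : IsDissipative T) (hd : Dense (T.domain : Set E)) :
    T.IsClosable := by
  refine isClosable_of_forall_zero fun y hy => ?_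
  have key : ∀ u ∈ T.domain, (inner ℂ y u).re ≤ 0 := by
    intro u hu
    have h1 : ∀ s : ℝ, 0 < s → (inner ℂ y u).re + s * (inner ℂ (T ⟨u, hu⟩) u).re ≤ 0 := by
      intro s hs
      have h2 := T.graph.topologicalClosure.add_mem hy (T.graph.topologicalClosure.smul_mem (s : ℂ)
        (T.graph.le_topologicalClosure (T.mem_graph ⟨u, hu⟩)))
      have h3 : (inner ℂ (y + (s : ℂ) • T ⟨u, hu⟩) ((s : ℂ) • u)).re ≤ 0 :=
        h.re_inner_le_of_mem_closure (by simpa using h2)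
      simp only [inner_add_left, inner_smul_left, inner_smul_right, Complex.conj_ofReal,
        Complex.add_re, Complex.re_ofReal_mul] at h3
      have h4 : s * ((inner ℂ y u).re + s * (inner ℂ (T ⟨u, hu⟩) u).re) ≤ s * 0 := by
        linarith
      exact le_of_mul_le_mul_left h4 hs
    have h5 : Tendsto (fun s : ℝ => (inner ℂ y u).re + s * (inner ℂ (T ⟨u, hu⟩) u).re)
        (𝓝[>] 0) (𝓝 ((inner ℂ y u).re)) := by
      have : Continuous fun s : ℝ => (inner ℂ y u).re + s * (inner ℂ (T ⟨u, hu⟩) u).re := by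
        fun_prop
      simpa using (this.tendsto 0).mono_left nhdsWithin_le_nhds
    refine le_of_tendsto h5 ?_
    filter_upwards [self_mem_nhdsWithin] with s hs
    exact h1 s hs
  have h6 : ∀ u, (inner ℂ y u).re ≤ 0 := fun u =>
    (isClosed_le (Complex.continuous_re.comp (continuous_const.inner continuous_id))
      continuous_const).closure_subset_iff.2 (fun u hu => key u hu) (hd u)
  exact (re_inner_self_nonpos (𝕜 := ℂ)).1 (h6 y)

theorem IsMDissipative.isClosed (h : IsMDissipative T) (hd : Dense (T.domain : Set E)) :
    T.IsClosed := by
  have hc := h.1.isClosable hd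
  have h1 : IsDissipative T.closure := isDissipative_iff_graph.2 fun u v huv =>
    h.1.re_inner_le_of_mem_closure (by rwa [hc.graph_closure_eq_closure_graph])
  have h2 : T = T.closure := le_antisymm T.le_closure (h.2 h1 T.le_closure)
  rw [h2]
  exact hc.closure_isClosed

theorem IsDissipative.re_mul_norm_le (h : IsDissipative T) {z : ℂ} {u v : E}
    (huv : (u, v) ∈ T.graph) : z.re * ‖u‖ ≤ ‖v - z • u‖ := by
  have h1 := isDissipative_iff_graph.1 h u v huv
  by_cases hu : u = 0
  · simp [hu]
  have h2 : (inner ℂ (v - z • u) u).re = (inner ℂ v u).re - z.re * ‖u‖ ^ 2 := by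
    have h3 : inner ℂ u u = ((‖u‖ ^ 2 : ℝ) : ℂ) := by
      rw [inner_self_eq_norm_sq_to_K]; norm_cast
    rw [inner_sub_left, inner_smul_left, h3, Complex.sub_re, Complex.re_mul_ofReal,
      Complex.conj_re]
  have h3 : -(inner ℂ (v - z • u) u).re ≤ ‖v - z • u‖ * ‖u‖ :=
    (neg_le_abs _).trans ((Complex.abs_re_le_norm _).trans (norm_inner_le_norm _ _))
  have h4 : 0 < ‖u‖ := norm_pos_iff.2 hu
  refine le_of_mul_le_mul_right ?_ h4
  nlinarith

/-- Maximality of a dissipative `T` forces the range of `T - z` to be dense: if `y` were orthogonal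
to it, `T` could be extended to `y` by `y ↦ -z̄ y`. -/
theorem IsMDissipative.eq_zero_of_orthogonal (h : IsMDissipative T) {z : ℂ} (hz : 0 < z.re) {y : E}
    (hy : ∀ u v, (u, v) ∈ T.graph → inner ℂ y (v - z • u) = 0) : y = 0 := by
  by_contra hy0
  have hpos : 0 < ‖y‖ := norm_pos_iff.2 hy0
  have hyy : inner ℂ y y = ((‖y‖ ^ 2 : ℝ) : ℂ) := by
    rw [inner_self_eq_norm_sq_to_K]; norm_cast
  have hyv : ∀ u v, (u, v) ∈ T.graph → inner ℂ y v = z * inner ℂ y u := fun u v huv => by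
    have := hy u v huv
    rwa [inner_sub_right, inner_smul_right, sub_eq_zero] at this
  have hnd : y ∉ T.domain := by
    intro hyd
    have h1 := T.mem_graph ⟨y, hyd⟩
    have h2 := hyv _ _ h1
    have h3 := h.1 ⟨y, hyd⟩
    simp only at h2
    rw [← inner_conj_symm, Complex.conj_re, h2, hyy, Complex.re_mul_ofReal] at h3
    have : 0 < z.re * ‖y‖ ^ 2 := by positivity
    linarith
  let T' := T.supSpanSingleton y (-(starRingEnd ℂ z) • y) hnd
  have hle : T ≤ T' := LinearPMap.left_le_sup _ _ _
  have hdiss : IsDissipative T' := by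
    rintro ⟨x, hx⟩
    obtain ⟨u, hu, _, hw, rfl⟩ := Submodule.mem_sup.1 hx
    obtain ⟨c, rfl⟩ := Submodule.mem_span_singleton.1 hw
    have e : T' ⟨u + c • y, hx⟩ = T ⟨u, hu⟩ + c • (-(starRingEnd ℂ z) • y) :=
      LinearPMap.supSpanSingleton_apply_mk T y _ hnd u hu c
    rw [e]
    have h1 := hyv _ _ (T.mem_graph ⟨u, hu⟩)
    simp only at h1
    have h2 : inner ℂ (T ⟨u, hu⟩) y = starRingEnd ℂ z * inner ℂ u y := by
      rw [← inner_conj_symm, h1, map_mul, inner_conj_symm]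
    have h3 : inner ℂ y u = starRingEnd ℂ (inner ℂ u y) := (inner_conj_symm _ _).symm
    have h4 := h.1 ⟨u, hu⟩
    simp only at h4
    simp only [inner_add_left, inner_add_right, inner_smul_left, inner_smul_right, h2, hyy, h3,
      map_neg, RingHomCompTriple.comp_apply, RingHom.id_apply]
    have h5 : 0 ≤ z.re * ‖y‖ ^ 2 * (c.re ^ 2 + c.im ^ 2) := by positivity
    simp only [Complex.add_re, Complex.add_im, Complex.mul_re, Complex.mul_im,
      Complex.neg_re, Complex.neg_im,
      Complex.conj_re, Complex.conj_im, Complex.ofReal_re, Complex.ofReal_im]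
    nlinarith
  have hmem : y ∈ T'.domain := Submodule.mem_sup_right (Submodule.mem_span_singleton_self y)
  exact hnd ((h.2 hdiss hle).1 hmem)

/-- The open right half-plane lies in the resolvent set of a densely defined m-dissipative
operator. -/
theorem IsMDissipative.exists_inverse [CompleteSpace E] (h : IsMDissipative T)
    (hd : Dense (T.domain : Set E)) {z : ℂ} (hz : 0 < z.re) :
    ∃ R : E →L[ℂ] E, IsInverseOfShift T z R ∧ ‖R‖ ≤ 1 / z.re := by
  -- `p` is `T - z` on the graph of `T`: bounded below, with closed and dense range
  let p : T.graph →ₗ[ℂ] E :=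
    (LinearMap.snd ℂ E E - z • LinearMap.fst ℂ E E) ∘ₗ T.graph.subtype
  have hp : ∀ q : T.graph, p q = (q : E × E).2 - z • (q : E × E).1 := fun q => rfl
  have hpc : Continuous p := by
    change Continuous fun q : T.graph => (q : E × E).2 - z • (q : E × E).1
    fun_prop
  have hb : ∀ q : T.graph, ‖(q : E × E).1‖ ≤ 1 / z.re * ‖p q‖ := by
    intro q
    have := h.1.re_mul_norm_le (z := z) q.2
    rw [hp, one_div, ← div_eq_inv_mul, le_div_iff₀ hz, mul_comm]
    exact this
  have hb' : ∀ q : T.graph, ‖q‖ ≤ (1 / z.re + 1 + ‖z‖ * (1 / z.re)) * ‖p q‖ := by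
    intro q
    have h1 := hb q
    have h2 : ‖(q : E × E).2‖ ≤ ‖p q‖ + ‖z‖ * (1 / z.re * ‖p q‖) := by
      have : (q : E × E).2 = p q + z • (q : E × E).1 := by rw [hp]; abel
      rw [this]
      refine (norm_add_le _ _).trans ?_
      rw [norm_smul]
      gcongr
    have h3 : 0 ≤ 1 / z.re * ‖p q‖ := by positivity
    have h4 : 0 ≤ ‖z‖ * (1 / z.re * ‖p q‖) := by positivity
    change max ‖(q : E × E).1‖ ‖(q : E × E).2‖ ≤ _
    refine max_le ?_ ?_ <;> linarith [norm_nonneg (p q)]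
  have : CompleteSpace T.graph := (h.isClosed hd).isComplete.completeSpace_coe
  obtain ⟨K, hK⟩ : ∃ K : ℝ≥0, AntilipschitzWith K p :=
    ⟨_, AddMonoidHomClass.antilipschitz_of_bound p
      (K := (⟨1 / z.re + 1 + ‖z‖ * (1 / z.re), by positivity⟩ : ℝ≥0)) hb'⟩
  have hclosed : IsClosed (LinearMap.range p : Set E) := by
    rw [LinearMap.coe_range]
    exact hK.isClosed_range
      ((⟨p, hpc⟩ : T.graph →L[ℂ] E).uniformContinuous)
  have hsurj : Function.Surjective p := by
    rw [← LinearMap.range_eq_top]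
    have : CompleteSpace (LinearMap.range p) := hclosed.isComplete.completeSpace_coe
    rw [← Submodule.orthogonal_eq_bot_iff, Submodule.eq_bot_iff]
    intro y hy
    refine h.eq_zero_of_orthogonal hz fun u v huv => ?_
    rw [Submodule.mem_orthogonal'] at hy
    exact hy _ ⟨⟨(u, v), huv⟩, rfl⟩
  let e : T.graph ≃ₗ[ℂ] E := LinearEquiv.ofBijective p ⟨hK.injective, hsurj⟩
  have he : ∀ q, e q = p q := fun q => rfl
  let R₀ : E →ₗ[ℂ] E := LinearMap.fst ℂ E E ∘ₗ T.graph.subtype ∘ₗ e.symm.toLinearMap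
  have hR₀ : ∀ y, R₀ y = (e.symm y : E × E).1 := fun y => rfl
  have hbound : ∀ y, ‖R₀ y‖ ≤ 1 / z.re * ‖y‖ := fun y => by
    have := hb (e.symm y)
    rwa [← he, e.apply_symm_apply] at this
  refine ⟨R₀.mkContinuous _ hbound, isInverseOfShift_of_graph ?_ ?_,
    R₀.mkContinuous_norm_le (by positivity) hbound⟩
  · intro y
    have h1 : e (e.symm y) = y := e.apply_symm_apply y
    rw [he, hp, sub_eq_iff_eq_add] at h1
    rw [LinearMap.mkContinuous_apply, hR₀, ← h1]
    exact (e.symm y).2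
  · intro x y hxy
    have h1 : e ⟨(x, y), hxy⟩ = y - z • x := rfl
    rw [LinearMap.mkContinuous_apply, hR₀, ← h1, e.symm_apply_apply]

end MDissipative

/-! ### Compact operators and strong convergence -/

section Compact

variable {E F G : Type*} [NormedAddCommGroup E] [NormedSpace ℂ E]
  [NormedAddCommGroup F] [NormedSpace ℂ F] [NormedAddCommGroup G] [NormedSpace ℂ G]

/-- Strong convergence of a bounded family is uniform on compact sets, so it becomes norm
convergence after composition with a compact operator. -/
theorem tendsto_norm_comp_of_isCompactOperator {ι : Type*} {l : Filter ι} {S : ι → F →L[ℂ] G}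
    {M : ℝ} (hM : ∀ᶠ i in l, ‖S i‖ ≤ M) (hS : ∀ x, Tendsto (fun i => S i x) l (𝓝 0))
    {C : E →L[ℂ] F} (hC : IsCompactOperator C) :
    Tendsto (fun i => ‖S i ∘L C‖) l (𝓝 0) := by
  obtain ⟨K, hK, hKC⟩ := hC.image_closedBall_subset_compact (f := (C : E →ₗ[ℂ] F)) 1
  rw [Metric.tendsto_nhds]
  intro ε hε
  obtain ⟨t, -, ht, hcov⟩ := hK.finite_cover_balls
    (show 0 < ε / (4 * (|M| + 1)) by positivity)
  have h1 : ∀ᶠ i in l, ∀ y ∈ t, ‖S i y‖ < ε / 4 := by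
    refine (eventually_all_finite ht).2 fun y _ => ?_
    filter_upwards [Metric.tendsto_nhds.1 (hS y) (ε / 4) (by positivity)] with i hi
    rwa [dist_zero_right] at hi
  filter_upwards [hM, h1] with i hi hit
  rw [dist_zero_right, norm_norm]
  refine lt_of_le_of_lt ?_ (half_lt_self hε)
  refine ContinuousLinearMap.opNorm_le_of_unit_norm (by positivity) fun x hx => ?_
  have hxK : C x ∈ K := hKC ⟨x, by simp [hx], rfl⟩
  obtain ⟨y, hy, hxy⟩ := Set.mem_iUnion₂.1 (hcov hxK)
  rw [Metric.mem_ball, dist_eq_norm] at hxy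
  have h2 : ‖S i (C x - y)‖ ≤ (|M| + 1) * (ε / (4 * (|M| + 1))) :=
    (S i).le_of_opNorm_le_of_le (hi.trans (by linarith [le_abs_self M])) hxy.le
  have h3 : (|M| + 1) * (ε / (4 * (|M| + 1))) = ε / 4 := by
    have : |M| + 1 ≠ 0 := by positivity
    field_simp
  have h4 := hit y hy
  calc ‖S i (C x)‖ = ‖S i (C x - y) + S i y‖ := by rw [map_sub, sub_add_cancel]
    _ ≤ ‖S i (C x - y)‖ + ‖S i y‖ := norm_add_le _ _
    _ ≤ ε / 2 := by linarith

end Compact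

section CompactHilbert

open scoped InnerProduct
open ContinuousLinearMap (adjoint)

variable {E F : Type*} [NormedAddCommGroup E] [InnerProductSpace ℂ E] [CompleteSpace E]
  [NormedAddCommGroup F] [InnerProductSpace ℂ F] [CompleteSpace F]

/-- If `R` is injective and `R Bᵢ → 0` in norm, then the adjoints of the bounded family `Bᵢ` tend to
`0` strongly, because the range of the adjoint of `R` is dense. Hence `G Bᵢ → 0` in norm for compact
`G`. -/
theorem tendsto_norm_comp_of_injective {ι : Type*} {l : Filter ι} {B : ι → E →L[ℂ] E} {M : ℝ}
    (hM : ∀ᶠ i in l, ‖B i‖ ≤ M) {R : E →L[ℂ] E} (hR : Function.Injective R)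
    (hRB : Tendsto (fun i => ‖R ∘L B i‖) l (𝓝 0)) {G : E →L[ℂ] F} (hG : IsCompactOperator G) :
    Tendsto (fun i => ‖G ∘L B i‖) l (𝓝 0) := by
  have hn : ∀ B : E →L[ℂ] E, ‖adjoint B‖ = ‖B‖ := fun B =>
    LinearIsometryEquiv.norm_map (adjoint (𝕜 := ℂ) (E := E) (F := E)) B
  have hdense : Dense (Set.range (adjoint R)) := by
    have h1 : ((adjoint R).range)ᗮ = ⊥ := by
      rw [ContinuousLinearMap.orthogonal_range, ContinuousLinearMap.adjoint_adjoint]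
      exact LinearMap.ker_eq_bot.2 hR
    rw [← Submodule.topologicalClosure_eq_top_iff] at h1
    exact (Submodule.dense_iff_topologicalClosure_eq_top).2 h1
  have hadj : ∀ v, Tendsto (fun i => adjoint (B i) v) l (𝓝 0) := by
    refine tendsto_apply_zero_of_dense (M := M) ?_ hdense ?_
    · filter_upwards [hM] with i hi
      rwa [hn]
    · rintro _ ⟨w, rfl⟩
      refine squeeze_zero_norm (a := fun i => ‖R ∘L B i‖ * ‖w‖) (fun i => ?_)
        (by simpa using hRB.mul_const ‖w‖)
      rw [← hn (R ∘L B i), ContinuousLinearMap.adjoint_comp]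
      exact ((adjoint (B i)).comp (adjoint R)).le_opNorm w
  -- `‖G B‖² = ‖(B* G*) G B‖`, and the compact factor `G` follows the strong null family `B* G*`
  let S : ι → F →L[ℂ] E := fun i => (adjoint (B i)).comp (adjoint G)
  have hS : ∀ᶠ i in l, ‖S i‖ ≤ |M| * ‖adjoint G‖ := by
    filter_upwards [hM] with i hi
    refine (ContinuousLinearMap.opNorm_comp_le (adjoint (B i)) (adjoint G)).trans ?_
    rw [hn]
    exact mul_le_mul_of_nonneg_right (hi.trans (le_abs_self M)) (norm_nonneg _)
  have h2 : Tendsto (fun i => ‖(S i).comp G‖) l (𝓝 0) :=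
    tendsto_norm_comp_of_isCompactOperator hS (fun x => hadj (adjoint G x)) hG
  have h3 : Tendsto (fun i => √(‖(S i).comp G‖ * |M|)) l (𝓝 0) := by
    simpa using (h2.mul_const |M|).sqrt
  refine squeeze_zero' (Eventually.of_forall fun _ => norm_nonneg _) ?_ h3
  filter_upwards [hM] with i hi
  refine Real.le_sqrt_of_sq_le ?_
  have h4 : (adjoint (G.comp (B i))).comp (G.comp (B i)) = ((S i).comp G).comp (B i) := by
    rw [ContinuousLinearMap.adjoint_comp]
    rfl
  rw [sq, ← ContinuousLinearMap.norm_adjoint_comp_self, h4]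
  exact (ContinuousLinearMap.opNorm_comp_le _ _).trans
    (mul_le_mul_of_nonneg_left (hi.trans (le_abs_self M)) (norm_nonneg _))

end CompactHilbert

/-! ### Relatively compact perturbations of the resolvent estimate -/

section Perturbation

variable {E F : Type*} [NormedAddCommGroup E] [NormedSpace ℂ E]
  [NormedAddCommGroup F] [NormedSpace ℂ F]

/-- The filter of points going to infinity inside the half-plane `Re z > ε`. -/
def halfPlaneAtInfinity (ε : ℝ) : Filter ℂ := comap norm atTop ⊓ 𝓟 {z | ε < z.re}

theorem eventually_halfPlaneAtInfinity {ε : ℝ} {p : ℂ → Prop} :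
    (∀ᶠ z in halfPlaneAtInfinity ε, p z) ↔ ∃ r : ℝ, ∀ z : ℂ, ε < z.re → r ≤ ‖z‖ → p z := by
  rw [halfPlaneAtInfinity, eventually_inf_principal, (atTop_basis.comap norm).eventually_iff]
  simp only [true_and, Set.mem_preimage, Set.mem_Ici, Set.mem_ofPred_eq]
  exact exists_congr fun r => forall_congr' fun z => imp.swap

/-- If `‖(S - z)⁻¹‖ = O(1 / |z|)`, then `S (S - z)⁻¹ = 1 + z (S - z)⁻¹` is bounded and tends to `0`
strongly at infinity, so that it tends to `0` in norm after composition with a compact operator.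
-/
theorem tendsto_norm_resolvent_comp_of_isCompactOperator {S : F →ₗ.[ℂ] F}
    (hd : Dense (S.domain : Set F)) {ε c : ℝ}
    (hS : ∀ z : ℂ, ε < z.re → z ∈ resolventSetOf S ∧ ‖resolventOf S z‖ ≤ c / ‖z‖)
    {C : E →L[ℂ] F} (hC : IsCompactOperator C) :
    Tendsto (fun z => ‖(1 + z • resolventOf S z) ∘L C‖) (halfPlaneAtInfinity ε) (𝓝 0) := by
  have hz : Tendsto (fun z : ℂ => c / ‖z‖) (halfPlaneAtInfinity ε) (𝓝 0) :=
    tendsto_const_nhds.div_atTop (tendsto_comap.mono_left inf_le_left)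
  have hM : ∀ᶠ z in halfPlaneAtInfinity ε, ‖1 + z • resolventOf S z‖ ≤
      ‖(1 : F →L[ℂ] F)‖ + |c| := by
    refine eventually_halfPlaneAtInfinity.2 ⟨1, fun z hzε hz1 => ?_⟩
    refine (norm_add_le _ _).trans (add_le_add_right ?_ _)
    have h1 : 0 < ‖z‖ := by linarith
    rw [norm_smul]
    calc ‖z‖ * ‖resolventOf S z‖ ≤ ‖z‖ * (c / ‖z‖) := by gcongr; exact (hS z hzε).2
      _ = c := by field_simp
      _ ≤ |c| := le_abs_self c
  refine tendsto_norm_comp_of_isCompactOperator hM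
    (tendsto_apply_zero_of_dense hM hd fun u hu => ?_) hC
  obtain ⟨v, huv⟩ := LinearPMap.mem_domain_iff.1 hu
  refine squeeze_zero_norm' (a := fun z => c / ‖z‖ * ‖v‖) ?_ (by simpa using hz.mul_const ‖v‖)
  refine eventually_halfPlaneAtInfinity.2 ⟨0, fun z hzε _ => ?_⟩
  have h1 := resolventOf_apply_of_mem_graph (hS z hzε).1 huv
  rw [map_sub, map_smul, sub_eq_iff_eq_add] at h1
  have h2 : (1 + z • resolventOf S z) u = resolventOf S z v := by
    simp [h1]
  rw [h2]
  exact (resolventOf S z).le_of_opNorm_le (hS z hzε).2 v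

/-- If `S Q = (1 - C) Q T + D Q` on the domain of `T` with `C` compact, `1 - C` bounded below and
`D` bounded, then the estimate `O(1 / |z|)` passes from the resolvent of `S` to the inverse of
`T - z` for large `z`. -/
theorem exists_norm_le_of_relativelyCompact {S : F →ₗ.[ℂ] F} {T : E →ₗ.[ℂ] E}
    (hd : Dense (S.domain : Set F)) {ε c : ℝ}
    (hS : ∀ z : ℂ, ε < z.re → z ∈ resolventSetOf S ∧ ‖resolventOf S z‖ ≤ c / ‖z‖)
    (Q : E ≃L[ℂ] F) {C : F →L[ℂ] F} (hC : IsCompactOperator C) {κ : ℝ}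
    (hκ : ∀ u, ‖u‖ ≤ κ * ‖u - C u‖) (D : F →L[ℂ] F)
    (hT : ∀ x y, (x, y) ∈ T.graph → (Q x, Q y - C (Q y) + D (Q x)) ∈ S.graph) :
    ∃ c' r : ℝ, ∀ z : ℂ, ε < z.re → r ≤ ‖z‖ → ∀ x y, (x, y) ∈ T.graph →
      ‖x‖ ≤ c' / ‖z‖ * ‖y - z • x‖ := by
  have h1 := tendsto_norm_resolvent_comp_of_isCompactOperator hd hS hC
  have h2 : Tendsto (fun z : ℂ => |c| / ‖z‖ * ‖D‖) (halfPlaneAtInfinity ε) (𝓝 0) := by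
    have := (tendsto_const_nhds (x := |c|)).div_atTop
      (tendsto_comap.mono_left (inf_le_left : halfPlaneAtInfinity ε ≤ comap norm atTop))
    have h := this.mul_const ‖D‖
    rwa [zero_mul] at h
  have h3 := (h1.add h2).const_mul |κ|
  simp only [add_zero, mul_zero] at h3
  obtain ⟨r, hr⟩ := eventually_halfPlaneAtInfinity.1
    (h3.eventually (ge_mem_nhds (show (0 : ℝ) < 1 / 2 by norm_num)))
  refine ⟨‖(Q.symm : F →L[ℂ] E)‖ * (2 * |κ| * |c| * (1 + ‖C‖) * ‖(Q : E →L[ℂ] F)‖), max r 1,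
    fun z hzε hzr x y hxy => ?_⟩
  have hz0 : 0 < ‖z‖ := by linarith [le_max_right r 1]
  obtain ⟨hzρ, hzc⟩ := hS z hzε
  have hzc' : ‖resolventOf S z‖ ≤ |c| / ‖z‖ := hzc.trans (by gcongr; exact le_abs_self c)
  set R := resolventOf S z with hR
  set u := Q x with hu
  set g := Q (y - z • x) with hg
  have hQy : Q y = g + z • u := by rw [hg, map_sub, map_smul, sub_add_cancel]
  have e1 := resolventOf_apply_of_mem_graph hzρ (hT x y hxy)
  rw [← hR, ← hu, hQy] at e1
  -- the equation `S u - z u = (1 - C) g - z C u + D u`, solved for `(1 - C) u`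
  have e2 : u - C u = R (g - C g) - ((1 + z • R) ∘L C) u + R (D u) := by
    have : R (g - C g) - ((1 + z • R) ∘L C) u + R (D u) =
        R (g + z • u - C (g + z • u) + D u - z • u) - C u := by
      simp only [ContinuousLinearMap.comp_apply, add_apply, smul_apply, one_apply_eq_self, map_sub,
        map_add, map_smul]
      abel
    rw [this, e1]
  have e3 : ‖R (g - C g)‖ ≤ |c| / ‖z‖ * ((1 + ‖C‖) * ‖g‖) := by
    refine R.le_of_opNorm_le_of_le hzc' ((norm_sub_le _ _).trans ?_)
    linarith [C.le_opNorm g]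
  have e4 : ‖R (D u)‖ ≤ |c| / ‖z‖ * ‖D‖ * ‖u‖ := by
    rw [mul_assoc]
    exact R.le_of_opNorm_le_of_le hzc' (D.le_opNorm u)
  have e5 : ‖((1 + z • R) ∘L C) u‖ ≤ ‖(1 + z • R) ∘L C‖ * ‖u‖ := ContinuousLinearMap.le_opNorm _ u
  have e6 : ‖u - C u‖ ≤ |c| / ‖z‖ * ((1 + ‖C‖) * ‖g‖) +
      (‖(1 + z • R) ∘L C‖ + |c| / ‖z‖ * ‖D‖) * ‖u‖ := by
    rw [e2]
    refine (norm_add_le _ _).trans ?_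
    linarith [norm_sub_le (R (g - C g)) (((1 + z • R) ∘L C) u)]
  have e7 : ‖u‖ ≤ 2 * |κ| * (|c| / ‖z‖ * ((1 + ‖C‖) * ‖g‖)) := by
    have h5 := hr z hzε ((le_max_left _ _).trans hzr)
    have h6 : ‖u‖ ≤ |κ| * ‖u - C u‖ :=
      (hκ u).trans (mul_le_mul_of_nonneg_right (le_abs_self κ) (norm_nonneg _))
    have h7 := mul_le_mul_of_nonneg_left e6 (abs_nonneg κ)
    have h8 := mul_le_mul_of_nonneg_right h5 (norm_nonneg u)
    rw [mul_add, ← mul_assoc] at h7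
    linarith
  have e8 : ‖x‖ ≤ ‖(Q.symm : F →L[ℂ] E)‖ * ‖u‖ := by
    have := (Q.symm : F →L[ℂ] E).le_opNorm u
    simpa [hu] using this
  have e9 : ‖g‖ ≤ ‖(Q : E →L[ℂ] F)‖ * ‖y - z • x‖ := (Q : E →L[ℂ] F).le_opNorm _
  calc ‖x‖ ≤ ‖(Q.symm : F →L[ℂ] E)‖ * ‖u‖ := e8
    _ ≤ ‖(Q.symm : F →L[ℂ] E)‖ * (2 * |κ| * (|c| / ‖z‖ *
        ((1 + ‖C‖) * (‖(Q : E →L[ℂ] F)‖ * ‖y - z • x‖)))) := by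
      gcongr
      exact e7.trans (by gcongr)
    _ = _ := by ring

/-- On the bounded part of the half-plane the resolvent is controlled by continuity. -/
theorem exists_resolvent_bound_of_large {T : E →ₗ.[ℂ] E} (hρ : rightHalfPlane ⊆ resolventSetOf T)
    {ε c r : ℝ} (hε : 0 < ε)
    (h : ∀ z : ℂ, ε < z.re → r ≤ ‖z‖ → ∀ x y, (x, y) ∈ T.graph → ‖x‖ ≤ c / ‖z‖ * ‖y - z • x‖) :
    ∃ C : ℝ, ∀ z : ℂ, ε < z.re → z ∈ resolventSetOf T ∧ ‖resolventOf T z‖ ≤ C / ‖z‖ := by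
  have hK : IsCompact (Metric.closedBall (0 : ℂ) r ∩ {z | ε ≤ z.re}) :=
    (isCompact_closedBall 0 r).inter_right (isClosed_le continuous_const Complex.continuous_re)
  have hid := isPseudoResolvent_neg_resolventOf hρ
  obtain ⟨M, hM⟩ := hK.exists_bound_of_continuousOn (f := fun z => -resolventOf T z)
    fun z hz => (hid.continuousAt
      (rightHalfPlane_mem_nhds (hε.trans_le hz.2))).continuousWithinAt
  refine ⟨max |c| (M * r), fun z hz => ⟨hρ (hε.trans hz), ?_⟩⟩
  have hz0 : 0 < ‖z‖ := (hε.trans hz).trans_le ((le_abs_self _).trans (Complex.abs_re_le_norm z))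
  rcases le_total r ‖z‖ with hr | hr
  · refine ContinuousLinearMap.opNorm_le_bound _ (by positivity) fun y => ?_
    have h1 := h z hz hr _ _ (resolventOf_mem_graph (hρ (hε.trans hz)) y)
    rw [add_sub_cancel_right] at h1
    refine h1.trans ?_
    gcongr
    exact (le_abs_self c).trans (le_max_left _ _)
  · have h1 := hM z ⟨by simpa using hr, hz.le⟩
    rw [norm_neg] at h1
    rw [le_div_iff₀ hz0]
    refine le_trans ?_ (le_max_right _ _)
    have := (norm_nonneg _).trans h1
    gcongr

end Perturbation

/-! ### Graphs of products, blocks and restrictions -/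

section Graphs

variable {E F G : Type*}
  [NormedAddCommGroup E] [NormedSpace ℂ E]
  [NormedAddCommGroup F] [NormedSpace ℂ F]
  [NormedAddCommGroup G] [NormedSpace ℂ G]

theorem mem_graph_total {R : E →L[ℂ] F} {x : E} {y : F} :
    (x, y) ∈ (total R).graph ↔ R x = y := by
  rw [LinearPMap.mem_graph_iff]
  constructor
  · rintro ⟨u, rfl, rfl⟩
    rfl
  · rintro rfl
    exact ⟨⟨x, trivial⟩, rfl, rfl⟩

theorem mem_graph_pmul {T₂ : F →ₗ.[ℂ] G} {T₁ : E →ₗ.[ℂ] F} {x : E} {z : G} :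
    (x, z) ∈ (pmul T₂ T₁).graph ↔ ∃ y, (x, y) ∈ T₁.graph ∧ (y, z) ∈ T₂.graph := by
  have key : ∀ (u : (pmul T₂ T₁).domain) (v : T₁.domain) (_ : (u : E) = v),
      ∃ h : T₁ v ∈ T₂.domain, pmul T₂ T₁ u = T₂ ⟨T₁ v, h⟩ := by
    rintro ⟨u, ⟨⟨y, hy, hyu⟩, hu⟩⟩ v huv
    have hyv : y = v := Subtype.ext (hyu.trans huv)
    subst hyv
    refine ⟨hy, ?_⟩
    have h : T₁.domRestrict ((T₂.domain.comap T₁.toFun).map T₁.domain.subtype)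
        ⟨u, ⟨⟨y, hy, hyu⟩, hu⟩⟩ = T₁ y := LinearPMap.domRestrict_apply huv
    change T₂ ⟨_, _⟩ = _
    congr 1
    exact Subtype.ext h
  rw [LinearPMap.mem_graph_iff]
  constructor
  · rintro ⟨u, rfl, rfl⟩
    obtain ⟨h, e⟩ := key u ⟨u, u.2.2⟩ rfl
    refine ⟨_, T₁.mem_graph ⟨u, u.2.2⟩, ?_⟩
    rw [e]
    exact T₂.mem_graph ⟨_, h⟩
  · rintro ⟨y, hxy, hyz⟩
    obtain ⟨v, rfl, rfl⟩ := (LinearPMap.mem_graph_iff _).1 hxy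
    obtain ⟨w, hw, rfl⟩ := (LinearPMap.mem_graph_iff _).1 hyz
    have hd : T₁ v ∈ T₂.domain := by
      simp only at hw
      exact hw ▸ w.2
    let u : (pmul T₂ T₁).domain := ⟨v, ⟨⟨v, hd, rfl⟩, v.2⟩⟩
    obtain ⟨h, e⟩ := key u v rfl
    refine ⟨u, rfl, ?_⟩
    rw [e]
    congr 1
    exact Subtype.ext hw.symm

theorem mem_graph_sub {T₁ T₂ : E →ₗ.[ℂ] F} {x : E} {y₁ y₂ : F} (h₁ : (x, y₁) ∈ T₁.graph)
    (h₂ : (x, y₂) ∈ T₂.graph) : (x, y₁ - y₂) ∈ (T₁ - T₂).graph := by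
  obtain ⟨u, hu, rfl⟩ := (LinearPMap.mem_graph_iff _).1 h₁
  obtain ⟨v, hv, rfl⟩ := (LinearPMap.mem_graph_iff _).1 h₂
  simp only at hu hv
  subst hu
  have hmem : (u : E) ∈ T₂.domain := hv ▸ v.2
  have e : T₂ ⟨u, hmem⟩ = T₂ v := congrArg T₂ (Subtype.ext hv.symm)
  refine (LinearPMap.mem_graph_iff _).2 ⟨⟨u, u.2, hmem⟩, rfl, ?_⟩
  change T₁ u - T₂ ⟨u, hmem⟩ = T₁ u - T₂ v
  rw [e]

theorem mem_graph_neg {T : E →ₗ.[ℂ] F} {x : E} {y : F} :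
    (x, y) ∈ (-T).graph ↔ (x, -y) ∈ T.graph := by
  simp only [LinearPMap.mem_graph_iff]
  constructor
  · rintro ⟨u, hu, rfl⟩
    exact ⟨u, hu, by simp⟩
  · rintro ⟨u, hu, h⟩
    exact ⟨u, hu, by simpa using congrArg Neg.neg h⟩

theorem graph_closure_le (T : E →ₗ.[ℂ] F) : T.closure.graph ≤ T.graph.topologicalClosure := by
  by_cases h : T.IsClosable
  · rw [h.graph_closure_eq_closure_graph]
  · rw [LinearPMap.closure_def' h]
    exact T.graph.le_topologicalClosure

theorem mem_graph_of_mem_graph_restrictTo {T : E →ₗ.[ℂ] E} {L : Submodule ℂ E}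
    {h : IsInvariantUnder T L} {x y : L} (hxy : (x, y) ∈ (restrictTo T L h).graph) :
    ((x : E), (y : E)) ∈ T.graph := by
  obtain ⟨u, rfl, rfl⟩ := (LinearPMap.mem_graph_iff _).1 hxy
  exact T.mem_graph ⟨_, u.2⟩

theorem dense_domain_restrictTo {T : E →ₗ.[ℂ] E} {L : Submodule ℂ E}
    (h : IsInvariantUnder T L) : Dense ((restrictTo T L h).domain : Set L) := by
  intro x
  rw [closure_subtype]
  refine closure_mono ?_ (h.1 x.2)
  rintro y ⟨hy, hyL⟩
  exact ⟨⟨y, hyL⟩, hy, rfl⟩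

/-- A densely defined bounded operator extends to a bounded operator on the whole space. -/
theorem IsBoundedOn.exists_extension [CompleteSpace F] {T : E →ₗ.[ℂ] F} (h : IsBoundedOn T)
    (hd : Dense (T.domain : Set E)) :
    ∃ R : E →L[ℂ] F, ∀ x y, (x, y) ∈ T.graph → R x = y := by
  refine ⟨T.toFun.extendOfNorm T.domain.subtype, fun x y hxy => ?_⟩
  obtain ⟨u, rfl, rfl⟩ := (LinearPMap.mem_graph_iff _).1 hxy
  exact LinearMap.extendOfNorm_eq (f := T.toFun) (e := T.domain.subtype)
    (by simpa [DenseRange] using hd) h u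

theorem IsCompactOn.exists_compact_extension {T : E →ₗ.[ℂ] F}
    (h : IsCompactOn T) :
    ∃ R : E →L[ℂ] F, IsCompactOperator R ∧ ∀ x, (x, R x) ∈ T.graph := by
  obtain ⟨hdom, hc⟩ := h
  have hmem : ∀ x, x ∈ T.domain := fun x => hdom ▸ trivial
  let i : E →L[ℂ] T.domain := (ContinuousLinearMap.id ℂ E).codRestrict T.domain hmem
  have hc' : IsCompactOperator (T.toFun ∘ₗ (i : E →ₗ[ℂ] T.domain)) := hc.comp_clm i
  refine ⟨ContinuousLinearMap.mkOfIsCompactOperator hc', hc', fun x => ?_⟩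
  exact T.mem_graph (i x)

variable {T : E →ₗ.[ℂ] E} {z w : ℂ}

theorem resolventOf_eq {R : E →L[ℂ] E} (h : IsInverseOfShift T z R) : resolventOf T z = R := by
  ext y
  have := resolventOf_apply_of_mem_graph (⟨R, h⟩ : z ∈ resolventSetOf T) (h.mem_graph y)
  rwa [add_sub_cancel_right] at this

theorem IsInverseOfShift.of_neg {R : E →L[ℂ] E} (h : IsInverseOfShift (-T) z R) :
    IsInverseOfShift T (-z) (-R) := by
  refine isInverseOfShift_of_graph (fun y => ?_) fun x y hxy => ?_
  · have := T.graph.neg_mem (mem_graph_neg.1 (h.mem_graph y))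
    simpa using this
  · have := h.apply_of_mem_graph (x := x) (y := -y) (mem_graph_neg.2 (by rwa [neg_neg]))
    rw [neg_apply, ← map_neg]
    convert! this using 2
    module

theorem injective_resolventOf (hz : z ∈ resolventSetOf T) :
    Function.Injective (resolventOf T z) := by
  rw [injective_iff_map_eq_zero]
  intro y hy
  have := resolventOf_mem_graph hz y
  rw [hy, smul_zero, add_zero] at this
  exact T.graph_fst_eq_zero_snd this rfl

/-- The bounded operator `1 + (z - w) (T - z)⁻¹` is `(T - w) (T - z)⁻¹`. -/
theorem resolventOf_comp_one_add (hz : z ∈ resolventSetOf T) (hw : w ∈ resolventSetOf T) (y : E) :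
    resolventOf T w (y + (z - w) • resolventOf T z y) = resolventOf T z y := by
  have := DFunLike.congr_fun (resolventOf_sub hw hz) y
  simp only [sub_apply, smul_apply, mul_apply_eq_comp] at this
  rw [map_add, map_smul]
  rw [sub_eq_iff_eq_add] at this
  rw [this]
  module

end Graphs

/-! ### Smallness of `A₁₂ (A₂₂ - μ)⁻¹` -/

section Small

variable {V W : Type*} [NormedAddCommGroup V] [InnerProductSpace ℂ V] [CompleteSpace V]
  [NormedAddCommGroup W] [InnerProductSpace ℂ W] [CompleteSpace W] {T : V →ₗ.[ℂ] V}

theorem IsMDissipative.mem_resolventSetOf_of_neg (h : IsMDissipative (-T))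
    (hd : Dense (T.domain : Set V)) {z : ℂ} (hz : z.re < 0) :
    z ∈ resolventSetOf T ∧ ‖resolventOf T z‖ ≤ 1 / -z.re := by
  obtain ⟨R, hR, hR'⟩ := h.exists_inverse hd (z := -z) (by simpa using hz)
  have h1 := hR.of_neg
  rw [neg_neg] at h1
  refine ⟨⟨-R, h1⟩, ?_⟩
  rw [resolventOf_eq h1, norm_neg]
  simpa using hR'

/-- If `B (T - μ₀)⁻¹` is compact, then `B (T - μ)⁻¹` is compact and arbitrarily small for suitable
`μ` in the left half-plane. -/
theorem exists_small_compact_comp_resolvent (h : IsMDissipative (-T))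
    (hd : Dense (T.domain : Set V)) {B : V →ₗ.[ℂ] W} {μ₀ : ℂ} (hμ₀ : μ₀.re < 0) {G₀ : V →L[ℂ] W}
    (hG₀ : IsCompactOperator G₀) (hG : ∀ w, (resolventOf T μ₀ w, G₀ w) ∈ B.graph) {δ : ℝ}
    (hδ : 0 < δ) :
    ∃ μ : ℂ, μ.re < 0 ∧ ∃ G : V →L[ℂ] W, IsCompactOperator G ∧ ‖G‖ ≤ δ ∧
      ∀ w, (resolventOf T μ w, G w) ∈ B.graph := by
  have hρ := fun {z : ℂ} (hz : z.re < 0) => (h.mem_resolventSetOf_of_neg hd hz)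
  let m : ℕ → ℂ := fun n => -((n : ℂ) + 1)
  have hm : ∀ n, (m n).re = -((n : ℝ) + 1) := fun n => by simp [m]
  have hm0 : ∀ n, (m n).re < 0 := fun n => by
    rw [hm]
    have : (0 : ℝ) ≤ n := n.cast_nonneg
    linarith
  have hR : ∀ n, ‖resolventOf T (m n)‖ ≤ 1 / ((n : ℝ) + 1) := fun n => by
    have := (hρ (hm0 n)).2
    rwa [hm, neg_neg] at this
  -- the operators `(T - μ₀) (T - m n)⁻¹`
  let K : ℕ → V →L[ℂ] V := fun n => 1 + (m n - μ₀) • resolventOf T (m n)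
  have hK : ∀ n, ‖K n‖ ≤ ‖(1 : V →L[ℂ] V)‖ + (1 + ‖μ₀‖) := fun n => by
    refine (norm_add_le _ _).trans (add_le_add_right ?_ _)
    rw [norm_smul]
    have h0 : (0 : ℝ) ≤ n := n.cast_nonneg
    have h1 : ‖m n - μ₀‖ ≤ ((n : ℝ) + 1) + ‖μ₀‖ := by
      refine (norm_sub_le _ _).trans (add_le_add_left ?_ _)
      rw [norm_neg]
      refine (norm_add_le _ _).trans ?_
      simp
    calc ‖m n - μ₀‖ * ‖resolventOf T (m n)‖ ≤
        (((n : ℝ) + 1) + ‖μ₀‖) * (1 / ((n : ℝ) + 1)) := by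
          gcongr
          exact hR n
      _ = 1 + ‖μ₀‖ / ((n : ℝ) + 1) := by field_simp
      _ ≤ 1 + ‖μ₀‖ := by
          gcongr
          exact div_le_self (norm_nonneg _) (by linarith)
  have hRK : ∀ n w, resolventOf T μ₀ (K n w) = resolventOf T (m n) w := fun n w =>
    resolventOf_comp_one_add (hρ (hm0 n)).1 (hρ hμ₀).1 w
  have hlim : Tendsto (fun n => ‖G₀ ∘L K n‖) atTop (𝓝 0) := by
    refine tendsto_norm_comp_of_injective (Eventually.of_forall hK)
      (injective_resolventOf (hρ hμ₀).1) ?_ hG₀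
    refine squeeze_zero (fun _ => norm_nonneg _) (fun n => ?_)
      (tendsto_one_div_add_atTop_nhds_zero_nat (𝕜 := ℝ))
    have : resolventOf T μ₀ ∘L K n = resolventOf T (m n) := ContinuousLinearMap.ext (hRK n)
    rw [this]
    exact hR n
  obtain ⟨n, hn⟩ := (hlim.eventually (ge_mem_nhds hδ)).exists
  refine ⟨m n, hm0 n, G₀ ∘L K n, hG₀.comp_clm (K n), hn, fun w => ?_⟩
  rw [← hRK]
  exact hG _

end Small

/-! ### Geometry of the indefinite inner product -/

section Geometry

variable {H : Type*} [NormedAddCommGroup H] [InnerProductSpace ℂ H] {J : H →L[ℂ] H}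

theorem mem_plusSpace {x : H} : x ∈ plusSpace J ↔ J x = x := by
  rw [LinearMap.mem_ker]
  simp [sub_eq_zero]

theorem mem_minusSpace {x : H} : x ∈ minusSpace J ↔ J x = -x := by
  rw [LinearMap.mem_ker]
  simp [add_eq_zero_iff_eq_neg]

variable {L : Submodule ℂ H}

theorem IsMaximalNonnegative.isClosed (hL : IsMaximalNonnegative J L) : IsClosed (L : Set H) := by
  have h1 : IsNonnegative J L.topologicalClosure := by
    have hc : IsClosed {x : H | 0 ≤ (inner ℂ (J x) x).re} :=
      isClosed_le continuous_const
        (Complex.continuous_re.comp (J.continuous.inner continuous_id))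
    exact fun x hx => closure_minimal (fun y hy => hL.1 y hy) hc hx
  rw [le_antisymm L.le_topologicalClosure (hL.2 h1 L.le_topologicalClosure)]
  exact L.isClosed_topologicalClosure

variable [CompleteSpace H]

/-- `P₊` as an operator onto `H⁺`. -/
def projPlus (J : H →L[ℂ] H) : H →L[ℂ] plusSpace J := (plusSpace J).orthogonalProjectionOnto

/-- `P₋` as an operator onto `H⁻`. -/
def projMinus (J : H →L[ℂ] H) : H →L[ℂ] minusSpace J := (minusSpace J).orthogonalProjectionOnto

namespace IsCanonicalSymmetry

theorem apply_apply (hJ : IsCanonicalSymmetry J) (x : H) : J (J x) = x := by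
  simpa using DFunLike.congr_fun hJ.2 x

theorem inner_apply_left (hJ : IsCanonicalSymmetry J) (x y : H) :
    inner ℂ (J x) y = inner ℂ x (J y) := by
  rw [← ContinuousLinearMap.adjoint_inner_right, hJ.1.adjoint_eq]

theorem coe_projPlus (hJ : IsCanonicalSymmetry J) (x : H) :
    (projPlus J x : H) = (2 : ℂ)⁻¹ • (x + J x) := by
  refine Submodule.eq_starProjection_of_mem_of_inner_eq_zero (mem_plusSpace.2 ?_) fun w hw => ?_
  · rw [map_smul, map_add, hJ.apply_apply, add_comm]
  · have e : x - (2 : ℂ)⁻¹ • (x + J x) = (2 : ℂ)⁻¹ • (x - J x) := by module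
    rw [e, inner_smul_left, inner_sub_left, hJ.inner_apply_left, mem_plusSpace.1 hw, sub_self,
      mul_zero]

theorem coe_projMinus (hJ : IsCanonicalSymmetry J) (x : H) :
    (projMinus J x : H) = (2 : ℂ)⁻¹ • (x - J x) := by
  refine Submodule.eq_starProjection_of_mem_of_inner_eq_zero (mem_minusSpace.2 ?_) fun w hw => ?_
  · rw [map_smul, map_sub, hJ.apply_apply, ← smul_neg, neg_sub]
  · have e : x - (2 : ℂ)⁻¹ • (x - J x) = (2 : ℂ)⁻¹ • (x + J x) := by module
    rw [e, inner_smul_left, inner_add_left, hJ.inner_apply_left, mem_minusSpace.1 hw,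
      inner_neg_right, add_neg_cancel, mul_zero]

theorem projPlus_add_projMinus (hJ : IsCanonicalSymmetry J) (x : H) :
    (projPlus J x : H) + projMinus J x = x := by
  rw [hJ.coe_projPlus, hJ.coe_projMinus]
  module

theorem projPlus_coe (hJ : IsCanonicalSymmetry J) (x : plusSpace J) : projPlus J x = x := by
  ext
  rw [hJ.coe_projPlus, mem_plusSpace.1 x.2]
  module

theorem projPlus_of_mem_minusSpace (hJ : IsCanonicalSymmetry J) {x : H} (hx : x ∈ minusSpace J) :
    projPlus J x = 0 := by
  ext
  rw [hJ.coe_projPlus, mem_minusSpace.1 hx, add_neg_cancel, smul_zero]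
  rfl

theorem projMinus_coe (hJ : IsCanonicalSymmetry J) (x : minusSpace J) : projMinus J x = x := by
  ext
  rw [hJ.coe_projMinus, mem_minusSpace.1 x.2]
  module

theorem projMinus_of_mem_plusSpace (hJ : IsCanonicalSymmetry J) {x : H} (hx : x ∈ plusSpace J) :
    projMinus J x = 0 := by
  ext
  rw [hJ.coe_projMinus, mem_plusSpace.1 hx, sub_self, smul_zero]
  rfl

theorem re_inner_apply_self (hJ : IsCanonicalSymmetry J) (x : H) :
    (inner ℂ (J x) x).re = ‖projPlus J x‖ ^ 2 - ‖projMinus J x‖ ^ 2 := by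
  set a := projPlus J x with ha
  set b := projMinus J x with hb
  have hx : x = a + b := (hJ.projPlus_add_projMinus x).symm
  have hJx : J x = a - b := by
    rw [hx, map_add, mem_plusSpace.1 a.2, mem_minusSpace.1 b.2, sub_eq_add_neg]
  have h1 : (inner ℂ (a : H) (a : H)).re = ‖a‖ ^ 2 := inner_self_eq_norm_sq (𝕜 := ℂ) (a : H)
  have h2 : (inner ℂ (b : H) (b : H)).re = ‖b‖ ^ 2 := inner_self_eq_norm_sq (𝕜 := ℂ) (b : H)
  have h3 : (inner ℂ (a : H) (b : H)).re = (inner ℂ (b : H) (a : H)).re :=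
    inner_re_symm (𝕜 := ℂ) (a : H) (b : H)
  rw [hJx]
  nth_rw 1 [hx]
  simp only [inner_sub_left, inner_add_right, Complex.sub_re, Complex.add_re]
  linarith

end IsCanonicalSymmetry

theorem IsMaximalNonnegative.norm_projMinus_le (hJ : IsCanonicalSymmetry J)
    (hL : IsMaximalNonnegative J L) {x : H} (hx : x ∈ L) : ‖projMinus J x‖ ≤ ‖projPlus J x‖ := by
  have := hL.1 x hx
  rw [hJ.re_inner_apply_self, sub_nonneg] at this
  exact le_of_sq_le_sq this (norm_nonneg _)

/-- A maximal nonnegative subspace is the graph of a contraction over `H⁺`: the projection `P₊` maps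
it isomorphically onto `H⁺`. Surjectivity holds because a vector of `H⁺` orthogonal to the range
could be adjoined to the subspace. -/
theorem IsMaximalNonnegative.exists_equiv (hJ : IsCanonicalSymmetry J)
    (hL : IsMaximalNonnegative J L) :
    ∃ Q : L ≃L[ℂ] plusSpace J, ∀ x : L, Q x = projPlus J x := by
  let f : L →L[ℂ] plusSpace J := projPlus J ∘L L.subtypeL
  have hf : ∀ x : L, f x = projPlus J x := fun x => rfl
  have : CompleteSpace L := hL.isClosed.isComplete.completeSpace_coe
  have hb : ∀ x : L, ‖x‖ ≤ (2 : ℝ≥0) * ‖f x‖ := fun x => by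
    have h1 := hL.norm_projMinus_le hJ x.2
    calc ‖(x : H)‖ = ‖(projPlus J (x : H) : H) + projMinus J (x : H)‖ := by
          rw [hJ.projPlus_add_projMinus]
      _ ≤ ‖projPlus J (x : H)‖ + ‖projMinus J (x : H)‖ := norm_add_le _ _
      _ ≤ (2 : ℝ≥0) * ‖f x‖ := by
          rw [hf]
          push_cast
          linarith
  have hanti : AntilipschitzWith 2 f := AddMonoidHomClass.antilipschitz_of_bound f hb
  have hrange : f.range = ⊤ := by
    have hclosed : IsClosed (f.range : Set (plusSpace J)) := by
      rw [LinearMap.coe_range]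
      exact hanti.isClosed_range f.uniformContinuous
    have : CompleteSpace f.range := hclosed.isComplete.completeSpace_coe
    rw [← Submodule.orthogonal_eq_bot_iff, Submodule.eq_bot_iff]
    intro e he
    have horth : ∀ x : L, inner ℂ (f x) e = 0 := fun x => he _ ⟨x, rfl⟩
    have hnn : IsNonnegative J (L ⊔ Submodule.span ℂ {(e : H)}) := by
      intro y hy
      obtain ⟨x, hx, _, hw, rfl⟩ := Submodule.mem_sup.1 hy
      obtain ⟨c, rfl⟩ := Submodule.mem_span_singleton.1 hw
      have h1 := hL.norm_projMinus_le hJ hx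
      have h2 : inner ℂ (projPlus J x) (c • e) = 0 := by
        rw [inner_smul_right, ← hf ⟨x, hx⟩, horth, mul_zero]
      rw [hJ.re_inner_apply_self, map_add, map_add, map_smul, map_smul, hJ.projPlus_coe,
        hJ.projMinus_of_mem_plusSpace e.2, smul_zero, add_zero, sub_nonneg, sq ‖_ + _‖,
        norm_add_sq_eq_norm_sq_add_norm_sq_of_inner_eq_zero _ _ h2]
      nlinarith [norm_nonneg (projMinus J x), norm_nonneg (c • e)]
    have heL : (e : H) ∈ L :=
      hL.2 hnn le_sup_left (Submodule.mem_sup_right (Submodule.mem_span_singleton_self _))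
    have h3 := horth ⟨e, heL⟩
    rw [hf, hJ.projPlus_coe] at h3
    exact inner_self_eq_zero.1 h3
  exact ⟨ContinuousLinearEquiv.ofBijective f (LinearMap.ker_eq_bot.2 hanti.injective) hrange,
    fun x => rfl⟩

end Geometry

/-! ### The block matrix -/

section Blocks

variable {H : Type*} [NormedAddCommGroup H] [InnerProductSpace ℂ H]
  {J : H →L[ℂ] H} {A : H →ₗ.[ℂ] H}

theorem mem_graph_block {M N : Submodule ℂ H} [N.HasOrthogonalProjection] {m : M} {y : H}
    (h : ((m : H), y) ∈ A.graph) : (m, N.orthogonalProjectionOnto y) ∈ (block A M N).graph := by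
  obtain ⟨u, hu, rfl⟩ := (LinearPMap.mem_graph_iff _).1 h
  simp only at hu
  have hm : (m : H) ∈ A.domain := hu ▸ u.2
  have e : u = ⟨m, hm⟩ := Subtype.ext hu
  subst e
  exact (block A M N).mem_graph ⟨m, hm⟩

variable [CompleteSpace H]

theorem projPlus_mem_domain (hJ : IsCanonicalSymmetry J)
    (hdom : A.domain = (A.domain ⊓ plusSpace J) ⊔ (A.domain ⊓ minusSpace J)) {x : H}
    (hx : x ∈ A.domain) : (projPlus J x : H) ∈ A.domain := by
  rw [hdom] at hx
  obtain ⟨p, hp, q, hq, rfl⟩ := Submodule.mem_sup.1 hx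
  rw [map_add, hJ.projPlus_of_mem_minusSpace hq.2, add_zero, hJ.projPlus_coe ⟨p, hp.2⟩]
  exact hp.1

theorem projMinus_mem_domain (hJ : IsCanonicalSymmetry J)
    (hdom : A.domain = (A.domain ⊓ plusSpace J) ⊔ (A.domain ⊓ minusSpace J)) {x : H}
    (hx : x ∈ A.domain) : (projMinus J x : H) ∈ A.domain := by
  rw [hdom] at hx
  obtain ⟨p, hp, q, hq, rfl⟩ := Submodule.mem_sup.1 hx
  rw [map_add, hJ.projMinus_of_mem_plusSpace hp.2, zero_add, hJ.projMinus_coe ⟨q, hq.2⟩]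
  exact hq.1

theorem dense_comap_plusSpace (hJ : IsCanonicalSymmetry J)
    (hdom : A.domain = (A.domain ⊓ plusSpace J) ⊔ (A.domain ⊓ minusSpace J))
    (hd : Dense (A.domain : Set H)) :
    Dense (A.domain.comap (plusSpace J).subtype : Set (plusSpace J)) := by
  intro a
  rw [← hJ.projPlus_coe a]
  exact map_mem_closure (projPlus J).continuous (hd a)
    fun x hx => projPlus_mem_domain hJ hdom hx

theorem dense_comap_minusSpace (hJ : IsCanonicalSymmetry J)
    (hdom : A.domain = (A.domain ⊓ plusSpace J) ⊔ (A.domain ⊓ minusSpace J))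
    (hd : Dense (A.domain : Set H)) :
    Dense (A.domain.comap (minusSpace J).subtype : Set (minusSpace J)) := by
  intro a
  rw [← hJ.projMinus_coe a]
  exact map_mem_closure (projMinus J).continuous (hd a)
    fun x hx => projMinus_mem_domain hJ hdom hx

variable {μ : ℂ} {G : minusSpace J →L[ℂ] plusSpace J}

/-- The values of the transfer function `S(μ)` when `G = G(μ)`. -/
theorem mem_graph_opS (hG : ∀ w, (resolventOf (A₂₂ J A) μ w, G w) ∈ (A₁₂ J A).graph)
    {a y₁₁ : plusSpace J} {y₂₁ : minusSpace J} (h₁₁ : (a, y₁₁) ∈ (A₁₁ J A).graph)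
    (h₂₁ : (a, y₂₁) ∈ (A₂₁ J A).graph) : (a, y₁₁ - G y₂₁) ∈ (opS J A μ).graph :=
  mem_graph_sub h₁₁ (mem_graph_pmul.2
    ⟨_, mem_graph_pmul.2 ⟨_, h₂₁, mem_graph_total.2 rfl⟩, hG y₂₁⟩)

/-- The Schur factorization of `A - μ`: the transfer function is recovered from the values of `A`
by `S(μ) P₊x = P₊Ax - G(μ) P₋(A - μ)x`. -/
theorem exists_schur (hJ : IsCanonicalSymmetry J)
    (hdom : A.domain = (A.domain ⊓ plusSpace J) ⊔ (A.domain ⊓ minusSpace J))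
    (hμ : μ ∈ resolventSetOf (A₂₂ J A))
    (hG : ∀ w, (resolventOf (A₂₂ J A) μ w, G w) ∈ (A₁₂ J A).graph) {x y : H}
    (hxy : (x, y) ∈ A.graph) :
    ∃ y₁₁ y₂₁, (projPlus J x, y₁₁) ∈ (A₁₁ J A).graph ∧ (projPlus J x, y₂₁) ∈ (A₂₁ J A).graph ∧
      y₁₁ - G y₂₁ = projPlus J y - G (projMinus J y - μ • projMinus J x) := by
  have hx := LinearPMap.mem_domain_of_mem_graph hxy
  obtain ⟨p, hp⟩ := LinearPMap.mem_domain_iff.1 (projPlus_mem_domain hJ hdom hx)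
  obtain ⟨q, hq⟩ := LinearPMap.mem_domain_iff.1 (projMinus_mem_domain hJ hdom hx)
  have hy : y = p + q := by
    have := A.graph.add_mem hp hq
    rw [Prod.mk_add_mk, hJ.projPlus_add_projMinus] at this
    exact A.mem_graph_snd_inj hxy this rfl
  refine ⟨projPlus J p, projMinus J p, mem_graph_block hp, mem_graph_block hp, ?_⟩
  have h₂₂ : (projMinus J x, projMinus J q) ∈ (A₂₂ J A).graph := mem_graph_block hq
  have h₁₂ : (projMinus J x, projPlus J q) ∈ (A₁₂ J A).graph := mem_graph_block hq
  have h := hG (projMinus J q - μ • projMinus J x)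
  rw [resolventOf_apply_of_mem_graph hμ h₂₂] at h
  have e : projPlus J q = G (projMinus J q - μ • projMinus J x) :=
    (A₁₂ J A).mem_graph_snd_inj h₁₂ h rfl
  have e' : projMinus J y - μ • projMinus J x =
      projMinus J p + (projMinus J q - μ • projMinus J x) := by
    rw [hy, map_add, add_sub_assoc]
  rw [e', map_add, ← e, hy, map_add]
  abel

end Blocks

/-! ### Restriction to the invariant subspace -/

section Restriction

variable {H : Type*} [NormedAddCommGroup H] [InnerProductSpace ℂ H] [CompleteSpace H]
  {J : H →L[ℂ] H} {A : H →ₗ.[ℂ] H} {L : Submodule ℂ H}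

/-- On `L`, where `P₋ = K P₊` with a contraction `K`, the relation between `A` and `S` becomes
`S P₊ = Λ (1 - G K) P₊ A + D P₊`, so `P₊` turns `A|_L` into a relatively compact perturbation of
`S`. -/
theorem generatesQuasiHolomorphic_restrictTo_of_relation (hJ : IsCanonicalSymmetry J)
    (hL : IsMaximalNonnegative J L) (hinv : IsInvariantUnder A.closure L)
    (hspec : spectrumOf (restrictTo A.closure L hinv) ⊆ {z : ℂ | z.re ≤ 0})
    {S : plusSpace J →ₗ.[ℂ] plusSpace J} (hSd : Dense (S.domain : Set (plusSpace J)))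
    (hS : GeneratesQuasiHolomorphic S) {G : minusSpace J →L[ℂ] plusSpace J}
    (hGc : IsCompactOperator G) (hG : ‖G‖ ≤ 1 / 2) (Λ : (plusSpace J →L[ℂ] plusSpace J)ˣ)
    (hΛ : IsCompactOperator (1 - Λ : plusSpace J →L[ℂ] plusSpace J))
    (D₁ : plusSpace J →L[ℂ] plusSpace J) (D₂ : minusSpace J →L[ℂ] plusSpace J)
    (hrel : ∀ x y, (x, y) ∈ A.graph → (projPlus J x,
      (Λ : plusSpace J →L[ℂ] plusSpace J) (projPlus J y - G (projMinus J y)) +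
        D₁ (projPlus J x) + D₂ (projMinus J x)) ∈ S.graph) :
    GeneratesQuasiHolomorphic (restrictTo A.closure L hinv) := by
  have : CompleteSpace L := hL.isClosed.isComplete.completeSpace_coe
  obtain ⟨Q, hQ⟩ := hL.exists_equiv hJ
  let K : plusSpace J →L[ℂ] minusSpace J := (projMinus J ∘L L.subtypeL) ∘L Q.symm
  have hKx : ∀ x : L, projMinus J x = K (Q x) := fun x => by simp [K]
  have hKn : ∀ u, ‖K u‖ ≤ ‖u‖ := fun u => by
    have h1 := hL.norm_projMinus_le hJ (Q.symm u).2
    rwa [← hQ, Q.apply_symm_apply] at h1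
  let Λ' : plusSpace J →L[ℂ] plusSpace J := Λ
  let C : plusSpace J →L[ℂ] plusSpace J := (1 - Λ') + Λ' ∘L (G ∘L K)
  have hC : IsCompactOperator C := hΛ.add ((hGc.comp_clm K).clm_comp Λ')
  have hCu : ∀ u, u - C u = Λ' (u - G (K u)) := fun u => by
    simp only [C, add_apply, sub_apply, one_apply_eq_self, ContinuousLinearMap.comp_apply, map_sub]
    abel
  have hκ : ∀ u, ‖u‖ ≤ 2 * ‖(↑Λ⁻¹ : plusSpace J →L[ℂ] plusSpace J)‖ * ‖u - C u‖ := by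
    intro u
    have h1 : ‖G (K u)‖ ≤ 1 / 2 * ‖u‖ := G.le_of_opNorm_le_of_le hG (hKn u)
    have h2 : ‖u‖ ≤ 2 * ‖u - G (K u)‖ := by
      have := norm_sub_norm_le u (G (K u))
      linarith
    have h3 : (↑Λ⁻¹ : plusSpace J →L[ℂ] plusSpace J) (Λ' (u - G (K u))) = u - G (K u) := by
      rw [← mul_apply_eq_comp, Units.inv_mul, one_apply_eq_self]
    have h4 := (↑Λ⁻¹ : plusSpace J →L[ℂ] plusSpace J).le_opNorm (Λ' (u - G (K u)))
    rw [h3] at h4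
    rw [hCu]
    linarith
  obtain ⟨c₁, hc₁⟩ := hS.2 1 one_pos
  have hclosed : S.IsClosed := isClosed_of_mem_resolventSetOf (hc₁ 2 (by norm_num)).1
  have hrel' : ∀ x y, (x, y) ∈ A.closure.graph → (projPlus J x,
      Λ' (projPlus J y - G (projMinus J y)) + D₁ (projPlus J x) + D₂ (projMinus J x)) ∈
        S.graph := by
    intro x y hxy
    have hc : IsClosed {p : H × H | (projPlus J p.1, Λ' (projPlus J p.2 - G (projMinus J p.2)) +
        D₁ (projPlus J p.1) + D₂ (projMinus J p.1)) ∈ (S.graph : Set _)} :=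
      hclosed.preimage (by fun_prop)
    exact closure_minimal (fun p hp => hrel p.1 p.2 hp) hc (graph_closure_le A hxy)
  have hρ : rightHalfPlane ⊆ resolventSetOf (restrictTo A.closure L hinv) := by
    intro z hz
    by_contra hzρ
    have h : z.re ≤ 0 := hspec hzρ
    exact h.not_gt hz
  refine generatesQuasiHolomorphic_of_resolvent_bound (dense_domain_restrictTo hinv)
    fun ε hε => ?_
  obtain ⟨c, hc⟩ := hS.2 ε hε
  obtain ⟨c', r, h⟩ := exists_norm_le_of_relativelyCompact hSd hc Q hC hκ (D₁ + D₂ ∘L K)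
    (T := restrictTo A.closure L hinv) fun x y hxy => by
      have h1 := hrel' _ _ (mem_graph_of_mem_graph_restrictTo hxy)
      rw [hKx, hKx, ← hQ, ← hQ, ← hCu, add_assoc] at h1
      exact h1
  exact exists_resolvent_bound_of_large hρ hε h

end Restriction

/-! ### The two hypotheses on the transfer function -/

section Cases

variable {H : Type*} [NormedAddCommGroup H] [InnerProductSpace ℂ H] [CompleteSpace H]
  {J : H →L[ℂ] H} {A : H →ₗ.[ℂ] H} {L : Submodule ℂ H}

/-- The case of a transfer function `S(μ₁)` generating a quasi-holomorphic semigroup. The parameter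
`μ` with `‖G(μ)‖ ≤ 1 / 2` may differ from `μ₁`, and `S(μ₁) - S(μ) = (μ - μ₁) G(μ₁) F(μ)` is
bounded. -/
theorem generatesQuasiHolomorphic_of_opS (hJ : IsCanonicalSymmetry J)
    (hdom : A.domain = (A.domain ⊓ plusSpace J) ⊔ (A.domain ⊓ minusSpace J))
    (hd : Dense (A.domain : Set H)) (h₂₂ : IsMDissipative (-A₂₂ J A))
    (hF : ∃ μ : ℂ, μ.re < 0 ∧ IsBoundedOn (opF J A μ))
    (hL : IsMaximalNonnegative J L) (hinv : IsInvariantUnder A.closure L)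
    (hspec : spectrumOf (restrictTo A.closure L hinv) ⊆ {z : ℂ | z.re ≤ 0})
    {μ₀ : ℂ} (hμ₀ : μ₀.re < 0) {G₀ : minusSpace J →L[ℂ] plusSpace J}
    (hG₀c : IsCompactOperator G₀)
    (hG₀ : ∀ w, (resolventOf (A₂₂ J A) μ₀ w, G₀ w) ∈ (A₁₂ J A).graph)
    {μ₁ : ℂ} (hμ₁ : μ₁.re < 0) (hS : GeneratesQuasiHolomorphic (opS J A μ₁).closure) :
    GeneratesQuasiHolomorphic (restrictTo A.closure L hinv) := by
  have hd₂ : Dense ((A₂₂ J A).domain : Set (minusSpace J)) := dense_comap_minusSpace hJ hdom hd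
  have hρ : ∀ {z : ℂ}, z.re < 0 → z ∈ resolventSetOf (A₂₂ J A) := fun hz =>
    (h₂₂.mem_resolventSetOf_of_neg hd₂ hz).1
  obtain ⟨μ, hμ, G, hGc, hGn, hG⟩ := exists_small_compact_comp_resolvent h₂₂ hd₂ hμ₀ hG₀c hG₀
    (show (0 : ℝ) < 1 / 2 by norm_num)
  set R := resolventOf (A₂₂ J A) with hR
  -- `G₁ = G(μ₁)` and, below, the bounded extension `F` of `F(μ)`
  obtain ⟨G₁, hG₁⟩ : ∃ G₁ : minusSpace J →L[ℂ] plusSpace J,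
      ∀ w, (R μ₁ w, G₁ w) ∈ (A₁₂ J A).graph := by
    refine ⟨G₀ ∘L (1 + (μ₁ - μ₀) • R μ₁), fun w => ?_⟩
    rw [hR, ← resolventOf_comp_one_add (hρ hμ₁) (hρ hμ₀) w]
    exact hG₀ _
  obtain ⟨ν, hν, hFν⟩ := hF
  have hmemF : ∀ {a y₂₁}, (a, y₂₁) ∈ (A₂₁ J A).graph → (a, R ν y₂₁) ∈ (opF J A ν).graph :=
    fun h => mem_graph_pmul.2 ⟨_, h, mem_graph_total.2 rfl⟩
  have hd₁ : Dense (A.domain.comap (plusSpace J).subtype : Set (plusSpace J)) :=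
    dense_comap_plusSpace hJ hdom hd
  have hdF : Dense ((opF J A ν).domain : Set (plusSpace J)) := hd₁.mono fun a ha =>
    LinearPMap.mem_domain_of_mem_graph (hmemF ((A₂₁ J A).mem_graph ⟨a, ha⟩))
  obtain ⟨F₀, hF₀⟩ := hFν.exists_extension hdF
  obtain ⟨F, hFa⟩ : ∃ F : plusSpace J →L[ℂ] minusSpace J,
      ∀ a y₂₁, (a, y₂₁) ∈ (A₂₁ J A).graph → F a = R μ y₂₁ := by
    refine ⟨(1 + (μ - ν) • R μ) ∘L F₀, fun a y₂₁ h => ?_⟩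
    have h1 := DFunLike.congr_fun (resolventOf_sub (hρ hμ) (hρ hν)) y₂₁
    simp only [sub_apply, smul_apply, mul_apply_eq_comp, sub_eq_iff_eq_add] at h1
    rw [← hR] at h1
    simp only [ContinuousLinearMap.comp_apply, add_apply, smul_apply, one_apply_eq_self,
      hF₀ _ _ (hmemF h)]
    rw [h1, add_comm]
  have hGG : ∀ w, G w = G₁ w + (μ - μ₁) • G₁ (R μ w) := fun w => by
    have h1 := hG₁ (w + (μ - μ₁) • R μ w)
    rw [hR, resolventOf_comp_one_add (hρ hμ) (hρ hμ₁) w, map_add, map_smul] at h1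
    exact (A₁₂ J A).mem_graph_snd_inj (hG w) h1 rfl
  have hSd : Dense ((opS J A μ₁).closure.domain : Set (plusSpace J)) := hd₁.mono fun a ha =>
    (opS J A μ₁).le_closure.1 (LinearPMap.mem_domain_of_mem_graph
      (mem_graph_opS hG₁ ((A₁₁ J A).mem_graph ⟨a, ha⟩) ((A₂₁ J A).mem_graph ⟨a, ha⟩)))
  refine generatesQuasiHolomorphic_restrictTo_of_relation hJ hL hinv hspec hSd hS hGc hGn 1
    (by simpa using! isCompactOperator_zero) ((μ - μ₁) • (G₁ ∘L F)) (μ • G) fun x y hxy => ?_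
  obtain ⟨y₁₁, y₂₁, h11, h21, e⟩ := exists_schur hJ hdom (hρ hμ) hG hxy
  have h1 := LinearPMap.le_graph_of_le (opS J A μ₁).le_closure (mem_graph_opS hG₁ h11 h21)
  convert! h1 using 2
  rw [map_sub, map_smul] at e
  have e2 : projPlus J y = y₁₁ - G y₂₁ + G (projMinus J y) - μ • G (projMinus J x) := by
    rw [e]; abel
  rw [e2, hGG y₂₁, Units.val_one, one_apply_eq_self, smul_apply, smul_apply,
    ContinuousLinearMap.comp_apply, hFa _ _ h21]
  abel

/-- `B = A₂₁ (A₁₁ - α)⁻¹` as an operator on the whole of `H⁺`. -/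
theorem exists_bounded_A₂₁ {α : ℂ} (hα : α ∈ resolventSetOf (A₁₁ J A))
    (hB : IsBoundedOn (pmul (A₂₁ J A) (total (resolventOf (A₁₁ J A) α)))) :
    ∃ B : plusSpace J →L[ℂ] minusSpace J, ∀ a y₁₁ y₂₁, (a, y₁₁) ∈ (A₁₁ J A).graph →
      (a, y₂₁) ∈ (A₂₁ J A).graph → B (y₁₁ - α • a) = y₂₁ := by
  obtain ⟨B, hB'⟩ := hB.exists_extension <| dense_univ.mono fun v _ => by
    have h1 : resolventOf (A₁₁ J A) α v ∈ (A₂₁ J A).domain :=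
      (LinearPMap.mem_domain_of_mem_graph (resolventOf_mem_graph hα v) :
        resolventOf (A₁₁ J A) α v ∈ (A₁₁ J A).domain)
    exact LinearPMap.mem_domain_of_mem_graph (mem_graph_pmul.2
      ⟨_, mem_graph_total.2 rfl, (A₂₁ J A).mem_graph ⟨_, h1⟩⟩)
  exact ⟨B, fun a y₁₁ y₂₁ h11 h21 => hB' _ _ (mem_graph_pmul.2
    ⟨_, mem_graph_total.2 (resolventOf_apply_of_mem_graph hα h11), h21⟩)⟩

/-- For compact `G` with `‖G B‖ < 1` the inverse of `1 - G B` is a compact perturbation of the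
identity. -/
theorem exists_unit_one_sub_comp {V W : Type*} [NormedAddCommGroup V] [NormedSpace ℂ V]
    [CompleteSpace V] [NormedAddCommGroup W] [NormedSpace ℂ W] {G : W →L[ℂ] V}
    (hG : IsCompactOperator G) (B : V →L[ℂ] W) (hGB : ‖G ∘L B‖ < 1) :
    ∃ Λ : (V →L[ℂ] V)ˣ, IsCompactOperator (1 - Λ : V →L[ℂ] V) ∧
      ∀ v, (Λ : V →L[ℂ] V) (v - G (B v)) = v := by
  let U : (V →L[ℂ] V)ˣ := Units.oneSub (G ∘L B) hGB
  have hU : (U : V →L[ℂ] V) = 1 - G ∘L B := rfl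
  have hΛU : ∀ v, (↑U⁻¹ : V →L[ℂ] V) (v - G (B v)) = v := fun v => by
    have := DFunLike.congr_fun U.inv_mul v
    rw [hU] at this
    simpa using this
  refine ⟨U⁻¹, ?_, hΛU⟩
  have e : (1 - ↑U⁻¹ : V →L[ℂ] V) = -((↑U⁻¹ : V →L[ℂ] V) ∘L (G ∘L B)) := by
    ext1 v
    have := hΛU v
    rw [map_sub] at this
    simp only [sub_apply, neg_apply, one_apply_eq_self, ContinuousLinearMap.comp_apply]
    nth_rw 1 [← this]
    abel
  rw [e]
  exact ((hG.comp_clm B).clm_comp _).neg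

/-- The case of a generator `A₁₁` with `A₂₁ = B (A₁₁ - α)` for a bounded `B`: the transfer function
is `(1 - G B) A₁₁` up to a bounded operator, and `1 - G B` is invertible once `G = G(μ)` is
small. -/
theorem generatesQuasiHolomorphic_of_A₁₁ (hJ : IsCanonicalSymmetry J)
    (hdom : A.domain = (A.domain ⊓ plusSpace J) ⊔ (A.domain ⊓ minusSpace J))
    (hd : Dense (A.domain : Set H)) (h₂₂ : IsMDissipative (-A₂₂ J A))
    (hL : IsMaximalNonnegative J L) (hinv : IsInvariantUnder A.closure L)
    (hspec : spectrumOf (restrictTo A.closure L hinv) ⊆ {z : ℂ | z.re ≤ 0})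
    {μ₀ : ℂ} (hμ₀ : μ₀.re < 0) {G₀ : minusSpace J →L[ℂ] plusSpace J}
    (hG₀c : IsCompactOperator G₀)
    (hG₀ : ∀ w, (resolventOf (A₂₂ J A) μ₀ w, G₀ w) ∈ (A₁₂ J A).graph)
    (h₁₁ : GeneratesQuasiHolomorphic (A₁₁ J A)) {α : ℂ} (hα : 0 < α.re)
    (hB : IsBoundedOn (pmul (A₂₁ J A) (total (resolventOf (A₁₁ J A) α)))) :
    GeneratesQuasiHolomorphic (restrictTo A.closure L hinv) := by
  have hd₂ : Dense ((A₂₂ J A).domain : Set (minusSpace J)) := dense_comap_minusSpace hJ hdom hd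
  have hαρ : α ∈ resolventSetOf (A₁₁ J A) := by
    obtain ⟨c, hc⟩ := h₁₁.2 (α.re / 2) (half_pos hα)
    exact (hc α (half_lt_self hα)).1
  obtain ⟨B, hBa⟩ := exists_bounded_A₂₁ hαρ hB
  obtain ⟨μ, hμ, G, hGc, hGn, hG⟩ := exists_small_compact_comp_resolvent h₂₂ hd₂ hμ₀ hG₀c hG₀
    (show (0 : ℝ) < 1 / (2 * (1 + ‖B‖)) by positivity)
  have hB0 := norm_nonneg B
  -- the bound chosen for `‖G‖` ensures both `‖G‖ ≤ 1 / 2` and `‖G B‖ < 1`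
  have hGn' : ‖G‖ ≤ 1 / 2 := hGn.trans (one_div_le_one_div_of_le (by norm_num) (by linarith))
  have hGB : ‖G ∘L B‖ < 1 := by
    refine (ContinuousLinearMap.opNorm_comp_le _ _).trans_lt ?_
    calc ‖G‖ * ‖B‖ ≤ 1 / (2 * (1 + ‖B‖)) * ‖B‖ := by gcongr
      _ < 1 := by
        rw [div_mul_eq_mul_div, one_mul, div_lt_one (by positivity)]
        linarith
  have hd₁ : Dense ((A₁₁ J A).domain : Set (plusSpace J)) := dense_comap_plusSpace hJ hdom hd
  obtain ⟨Λ, hΛc, hΛU⟩ := exists_unit_one_sub_comp hGc B hGB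
  refine generatesQuasiHolomorphic_restrictTo_of_relation hJ hL hinv hspec
    hd₁ h₁₁ hGc hGn' Λ hΛc
    (-(α • ((Λ : plusSpace J →L[ℂ] plusSpace J) ∘L (G ∘L B))))
    (μ • ((Λ : plusSpace J →L[ℂ] plusSpace J) ∘L G)) fun x y hxy => ?_
  obtain ⟨y₁₁, y₂₁, h11, h21, e⟩ := exists_schur hJ hdom
    (h₂₂.mem_resolventSetOf_of_neg hd₂ hμ).1 hG hxy
  have e1 : y₁₁ - G (B y₁₁) = projPlus J y - G (projMinus J y) + μ • G (projMinus J x) -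
      α • G (B (projPlus J x)) := by
    rw [← hBa _ _ _ h11 h21, map_sub, map_sub, map_sub, map_smul, map_smul, map_smul] at e
    rw [eq_sub_iff_add_eq, sub_add, e]
    abel
  have e2 := hΛU y₁₁
  rw [e1, map_sub, map_add, map_smul, map_smul] at e2
  rw [neg_apply, smul_apply, smul_apply, ContinuousLinearMap.comp_apply,
    ContinuousLinearMap.comp_apply, ContinuousLinearMap.comp_apply, add_right_comm,
    ← sub_eq_add_neg, e2]
  exact h11

end Cases

end

end KreinSpace

theorem mainTheorem3
    {H : Type*} [NormedAddCommGroup H] [InnerProductSpace ℂ H] [CompleteSpace H]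
    [TopologicalSpace.SeparableSpace H]
    (J : H →L[ℂ] H) (hJ : KreinSpace.IsCanonicalSymmetry J)
    (A : H →ₗ.[ℂ] H)
    (hA_dom : A.domain = (A.domain ⊓ KreinSpace.plusSpace J) ⊔ (A.domain ⊓ KreinSpace.minusSpace J))
    (hA_dense : Dense (A.domain : Set H))
    (hA_diss : KreinSpace.IsJDissipative J A)
    (hA₂₂ : KreinSpace.IsMDissipative (-KreinSpace.A₂₂ J A))
    (hF : ∃ μ : ℂ, μ.re < 0 ∧ KreinSpace.IsBoundedOn (KreinSpace.opF J A μ))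
    (hG : ∃ μ : ℂ, μ.re < 0 ∧ KreinSpace.IsCompactOn (KreinSpace.opG J A μ))
    (hA_m : KreinSpace.IsJMDissipative J A.closure)
    (L : Submodule ℂ H) (hL : KreinSpace.IsMaximalNonnegative J L)
    (hL_inv : KreinSpace.IsInvariantUnder A.closure L)
    (hL_spec : KreinSpace.spectrumOf (KreinSpace.restrictTo A.closure L hL_inv) ⊆
      {z : ℂ | z.re ≤ 0})
    (hS :
      (∃ μ : ℂ, μ.re < 0 ∧ KreinSpace.GeneratesQuasiHolomorphic (KreinSpace.opS J A μ).closure) ∨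
      (KreinSpace.GeneratesQuasiHolomorphic (KreinSpace.A₁₁ J A) ∧
        ∃ α₀ : ℂ, 0 < α₀.re ∧ KreinSpace.IsBoundedOn
          (KreinSpace.pmul (KreinSpace.A₂₁ J A)
            (KreinSpace.total (KreinSpace.resolventOf (KreinSpace.A₁₁ J A) α₀))))) :
    KreinSpace.GeneratesQuasiHolomorphic (KreinSpace.restrictTo A.closure L hL_inv) := by
  obtain ⟨μ₀, hμ₀, hGμ₀⟩ := hG
  obtain ⟨G₀, hG₀c, hG₀⟩ := hGμ₀.exists_compact_extension
  have hG₀' : ∀ w, (KreinSpace.resolventOf (KreinSpace.A₂₂ J A) μ₀ w, G₀ w) ∈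
      (KreinSpace.A₁₂ J A).graph := fun w => by
    obtain ⟨v, hv, hvG⟩ := KreinSpace.mem_graph_pmul.1 (hG₀ w)
    rwa [KreinSpace.mem_graph_total.1 hv]
  rcases hS with ⟨μ₁, hμ₁, hS⟩ | ⟨h₁₁, α₀, hα₀, hB⟩
  · exact KreinSpace.generatesQuasiHolomorphic_of_opS hJ hA_dom hA_dense hA₂₂ hF hL hL_inv hL_spec
      hμ₀ hG₀c hG₀' hμ₁ hS
  · exact KreinSpace.generatesQuasiHolomorphic_of_A₁₁ hJ hA_dom hA_dense hA₂₂ hL hL_inv hL_spec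
      hμ₀ hG₀c hG₀' h₁₁ hα₀ hB
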